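/- Let $d \ge 1$ and let $\mathbb{P}(\mathbb{R}^d)$ be real projective space with its usual topology and the usual action of $\mathrm{PGL}_d(\mathbb{R})$. An affine chart of $\mathbb{P}(\mathbb{R}^d)$ is the complement of a projective hyperplane. A subset of $\mathbb{P}(\mathbb{R}^d)$ is convex if it is a convex subset of some affine chart, and a properly convex domain is an open subset of $\mathbb{P}(\mathbb{R}^d)$ that is a bounded convex subset of some affine chart. For a properly convex domain $\Omega$ put $\mathrm{Aut}(\Omega)=\{g\in \mathrm{PGL}_d(\mathbb{R}) : g\Omega=\Omega\}$, and for $X\subset\mathbb{P}(\mathbb{R}^d)$ put $\mathrm{Stab}_\Omega(X)=\{g\in \mathrm{Aut}(\Omega) : gX=X\}$. A group $G$ preserving a set $X$ acts co-compactly on $X$ if the quotient space $G\backslash X$ is compact (that is, every open cover has a finite subcover). A simplex is a set $S\subset\mathbb{P}(\mathbb{R}^d)$ for which there are $g\in\mathrm{PGL}_d(\mathbb{R})$ and $1\le k\le d$ with $$gS=\{[x_1:\dots:x_k:0:\dots:0] : x_1>0,\dots,x_k>0\};$$ its vertices are then the $k$ points $g^{-1}[e_1],\dots,g^{-1}[e_k]$,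 where $e_1,\dots,e_d$ is the standard basis of $\mathbb{R}^d$. A subset $A\subset B$ of $\mathbb{P}(\mathbb{R}^d)$ is properly embedded in $B$ if the inclusion $A\hookrightarrow B$ is a proper map for the subspace topologies. **Theorem.** Let $\Omega\subset\mathbb{P}(\mathbb{R}^d)$ be a properly convex domain, let $\mathcal{C}\subset\Omega$ be a non-empty convex subset that is closed in $\Omega$, and let $G\le\mathrm{Stab}_\Omega(\mathcal{C})$ be a subgroup (not necessarily discrete). If $G$ is Abelian and acts co-compactly on $\mathcal{C}$, then there exists a simplex $S\subset\mathcal{C}$, properly embedded in $\mathcal{C}$, such that 1. $G\le\mathrm{Stab}_\Omega(S)$, 2. $G$ acts co-compactly on $S$, and 3. $G$ fixes each vertex of $S$. -/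

import Mathlib

open scoped Pointwise

namespace ConvexProj

/-- The real projective space `ℙ(ℝ^d)` of lines through the origin of `ℝ^d`. -/
abbrev RP (d : ℕ) : Type := Projectivization ℝ (Fin d → ℝ)

/-- The projective linear group `PGL_d(ℝ)`; it acts on `RP d` through Mathlib's action. -/
abbrev PGL (d : ℕ) : Type := Matrix.ProjGenLinGroup (Fin d) ℝ

/-- The standard topology on `ℙ(ℝ^d)`: the quotient topology from `ℝ^d ∖ {0}`. -/
instance instTopologicalSpaceRP (d : ℕ) : TopologicalSpace (RP d) :=
  inferInstanceAs (TopologicalSpace (Quotient (projectivizationSetoid ℝ (Fin d → ℝ))))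

/-- The affine chart of `ℙ(ℝ^d)` given by a linear functional `φ` on `ℝ^d`:
the complement of the hyperplane `φ = 0`. -/
def affineChart {d : ℕ} (φ : Module.Dual ℝ (Fin d → ℝ)) : Set (RP d) :=
  {p | φ p.rep ≠ 0}

/-- The coordinate of a point of the chart `affineChart φ`: the representative of the line
on the affine hyperplane `φ = 1`. -/
noncomputable def affineCoord {d : ℕ} (φ : Module.Dual ℝ (Fin d → ℝ)) (p : RP d) : Fin d → ℝ :=
  (φ p.rep)⁻¹ • p.rep

theorem mk_mem_affineChart {d : ℕ} (φ : Module.Dual ℝ (Fin d → ℝ)) (v : Fin d → ℝ) (hv : v ≠ 0) :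
    Projectivization.mk ℝ v hv ∈ affineChart φ ↔ φ v ≠ 0 := by
  obtain ⟨a, ha⟩ := Projectivization.exists_smul_eq_mk_rep ℝ v hv
  have h : φ (Projectivization.mk ℝ v hv).rep = (a : ℝ) * φ v := by
    rw [← ha, Units.smul_def, map_smul, smul_eq_mul]
  simp [affineChart, h]

theorem affineCoord_mk {d : ℕ} (φ : Module.Dual ℝ (Fin d → ℝ)) (v : Fin d → ℝ) (hv : v ≠ 0) :
    affineCoord φ (Projectivization.mk ℝ v hv) = (φ v)⁻¹ • v := by
  obtain ⟨a, ha⟩ := Projectivization.exists_smul_eq_mk_rep ℝ v hv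
  have h0 : (a : ℝ) ≠ 0 := a.ne_zero
  rw [affineCoord, ← ha, Units.smul_def, map_smul, smul_eq_mul, smul_smul]
  congr 1
  field_simp

/-- A subset of `ℙ(ℝ^d)` is convex if it is a convex subset of some affine chart. -/
def IsConvex {d : ℕ} (C : Set (RP d)) : Prop :=
  ∃ φ : Module.Dual ℝ (Fin d → ℝ), φ ≠ 0 ∧ C ⊆ affineChart φ ∧ Convex ℝ (affineCoord φ '' C)

/-- A subset of `ℙ(ℝ^d)` is properly convex if it is a bounded convex subset of some affine
chart. -/
def IsProperlyConvex {d : ℕ} (C : Set (RP d)) : Prop :=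
  ∃ φ : Module.Dual ℝ (Fin d → ℝ), φ ≠ 0 ∧ C ⊆ affineChart φ ∧
    Convex ℝ (affineCoord φ '' C) ∧ Bornology.IsBounded (affineCoord φ '' C)

/-- A properly convex domain: a properly convex set that is open in `ℙ(ℝ^d)`. -/
def IsProperlyConvexDomain {d : ℕ} (Ω : Set (RP d)) : Prop :=
  IsProperlyConvex Ω ∧ IsOpen Ω

/-- The automorphism group `Aut(Ω) = {g ∈ PGL_d(ℝ) : g Ω = Ω}`. -/
noncomputable def Aut {d : ℕ} (Ω : Set (RP d)) : Subgroup (PGL d) :=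
  MulAction.stabilizer (PGL d) Ω

/-- The stabilizer `Stab_Ω(X) = {g ∈ Aut(Ω) : g X = X}`. -/
noncomputable def Stab {d : ℕ} (Ω X : Set (RP d)) : Subgroup (PGL d) :=
  Aut Ω ⊓ MulAction.stabilizer (PGL d) X

/-- `G` acts co-compactly on `X`: the set `X` is `G`-invariant and the quotient `G \ X` of the
space `X` by the relation of lying in the same `G`-orbit is compact. -/
def ActsCocompactlyOn {d : ℕ} (G : Subgroup (PGL d)) (X : Set (RP d)) : Prop :=
  (∀ g ∈ G, g • X = X) ∧
    CompactSpace (Quotient ((MulAction.orbitRel G (RP d)).comap (Subtype.val : X → RP d)))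

/-- `A` is a properly embedded subset of `B`: `A ⊆ B`, and the inclusion map `A → B` is proper
for the subspace topologies. -/
def IsProperlyEmbedded {d : ℕ} (A B : Set (RP d)) : Prop :=
  ∃ h : A ⊆ B, IsProperMap (Set.inclusion h)

/-- The standard open simplex `{[x₁ : ⋯ : x_k : 0 : ⋯ : 0] : x₁ > 0, …, x_k > 0}`. -/
def standardSimplex (d k : ℕ) : Set (RP d) :=
  {p | ∃ (x : Fin d → ℝ) (hx : x ≠ 0), p = Projectivization.mk ℝ x hx ∧
    ∀ i : Fin d, ((i : ℕ) < k → 0 < x i) ∧ (k ≤ (i : ℕ) → x i = 0)}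

/-- The coordinate point `[0 : ⋯ : 0 : 1 : 0 : ⋯ : 0]` of `ℙ(ℝ^d)`. -/
noncomputable def coordPoint {d : ℕ} (i : Fin d) : RP d :=
  Projectivization.mk ℝ (Pi.single i 1) (by simp)

/-- `S ⊆ ℙ(ℝ^d)` is a `(k - 1)`-dimensional (open) simplex with vertices `v₁, …, v_k`, where
`1 ≤ k ≤ d`: some `g ∈ PGL_d(ℝ)` carries `S` onto the standard simplex and each `v_i` to the
corresponding coordinate point. -/
def IsSimplexWithVertices {d k : ℕ} (S : Set (RP d)) (v : Fin k → RP d) : Prop :=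
  1 ≤ k ∧ ∃ (hk : k ≤ d) (g : PGL d), g • S = standardSimplex d k ∧
    ∀ i : Fin k, v i = g⁻¹ • coordPoint (Fin.castLE hk i)

end ConvexProj

/-!
The simplex is any minimal non-empty relatively closed convex `G`-invariant subset `S` of `C`.
Such a set exists by Zorn's lemma, because the relatively closed invariant subsets of `C`
correspond to closed subsets of the compact quotient `G \ C` (`exists_minimal_invariant`).

To see that `S` is a simplex, lift `G` to `GL_d(ℝ)` by choosing lifts that preserve the open cone
over `Ω`. Two such lifts commute, since their commutator is a positive scalar of determinant one
(`exists_lift`, `commute_of_lift`). Let `D` be the cone over `S`, `K` its closure and `V` its span.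
Since `Ω` is bounded in an affine chart, `K` is salient, and minimality of `S` says that every
closed convex invariant subcone of `K` that meets `D` is `K` (`isMinimalCone_coneOver`). This has
the following consequences.

* A salient closed cone preserved by commuting linear maps contains a common eigenvector
  (`exists_common_eigenvector`), and then there is a common eigenvector of the transposes with the
  same eigenvalues (`exists_dual_eigenvector`, by Nakayama's lemma).
* An eigenfunctional `f` with non-negative eigenvalues is, up to sign, positive on `D`: consider
  the subcones `f ≥ 0` and `f = 0`. In particular, two of them with the same eigenvalues
  are proportional (`exists_pos_dual_eigenvector`, `exists_eq_smul`).
* If `e ∈ K` is a common eigenvector and `f` is an eigenfunctional with the same eigenvalues, then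
  `{x ∈ K | x - s f(x) e ∈ K}` is an invariant subcone. It meets `D` for small `s > 0`, so the map
  `x ↦ x - s f(x) e` preserves `K`. Composing such maps one finds that `f(e) > 0`, and that
  `s = 1 / f(e)` is possible: the projection along `e` onto the kernel of `f` preserves `K`
  (`exists_projection`).

Hence one can split off one eigenvector after the other: as long as the functionals found so far
have a common zero in `V`, the projections map `K` onto a non-zero invariant cone in their common
kernel, which contains a further common eigenvector (`EigenSystem.extend`). The process ends with
a basis of `V` consisting of common eigenvectors that span `K`, and `D` is the interior of `K`
(`exists_simplicial`). So `S` is an open simplex with fixed vertices. It is relatively closed in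
`C`, hence properly embedded, and inherits co-compactness from `C`.
-/

namespace ConvexProj

/-! ### Closed cones and common eigenvectors -/

/-- A closed convex cone with apex `0`, as a set. -/
structure IsClosedCone {V : Type*} [AddCommGroup V] [Module ℝ V] [TopologicalSpace V]
    (N : Set V) : Prop where
  isClosed : IsClosed N
  zero_mem : (0 : V) ∈ N
  add_mem : ∀ x ∈ N, ∀ y ∈ N, x + y ∈ N
  smul_mem : ∀ c : ℝ, 0 ≤ c → ∀ x ∈ N, c • x ∈ N

/-- Zorn's lemma in a compact space: a family of closed sets that is stable under intersections
of non-empty subfamilies has a minimal non-empty member below each of its non-empty members. -/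
theorem exists_minimal_nonempty_of_isClosed {Y : Type*} [TopologicalSpace Y] [CompactSpace Y]
    (P : Set Y → Prop) (hcl : ∀ B, P B → IsClosed B)
    (hInter : ∀ c : Set (Set Y), c.Nonempty → (∀ B ∈ c, P B) → P (⋂₀ c))
    {B₀ : Set Y} (hB₀ : P B₀) (hne : B₀.Nonempty) :
    ∃ B, P B ∧ B.Nonempty ∧ B ⊆ B₀ ∧ ∀ B', P B' → B'.Nonempty → B' ⊆ B → B' = B := by
  obtain ⟨B, hBB₀, hB⟩ := zorn_superset_nonempty {B | P B ∧ B.Nonempty} (by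
    intro c hc hchain hcne
    refine ⟨⋂₀ c, ⟨hInter c hcne fun B hB => (hc hB).1, ?_⟩,
      fun s hs => Set.sInter_subset_of_mem hs⟩
    have : Nonempty c := hcne.to_subtype
    refine IsCompact.nonempty_sInter_of_directed_nonempty_isCompact_isClosed ?_
      (fun s hs => (hc hs).2) (fun s hs => (hcl s (hc hs).1).isCompact)
      fun s hs => hcl s (hc hs).1
    intro s hs t ht
    rcases hchain.total hs ht with h | h
    · exact ⟨s, hs, subset_rfl, h⟩
    · exact ⟨t, ht, h, subset_rfl⟩) B₀ ⟨hB₀, hne⟩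
  refine ⟨B, hB.prop.1, hB.prop.2, hBB₀, fun B' h1 h2 h3 => ?_⟩
  exact h3.antisymm (hB.le_of_le ⟨h1, h2⟩ h3)

/-- A convex cone has an internal point with respect to its span. -/
theorem exists_internal_point {V : Type*} [AddCommGroup V] [Module ℝ V] [FiniteDimensional ℝ V]
    {Q : Set V} (h0 : (0 : V) ∈ Q) (hadd : ∀ x ∈ Q, ∀ y ∈ Q, x + y ∈ Q)
    (hsmul : ∀ c : ℝ, 0 ≤ c → ∀ x ∈ Q, c • x ∈ Q) :
    ∃ q ∈ Q, ∀ z ∈ Submodule.span ℝ Q, ∃ ε : ℝ, 0 < ε ∧ q - ε • z ∈ Q := by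
  obtain ⟨t, htQ, ht⟩ := (Submodule.fg_span_iff_fg_span_finset_subset Q).1
    (IsNoetherian.noetherian (Submodule.span ℝ Q))
  have hsum : ∀ c : V → ℝ, (∀ b ∈ t, 0 ≤ c b) → ∑ b ∈ t, c b • b ∈ Q := fun c hc =>
    Finset.sum_induction _ (· ∈ Q) (fun a b ha hb => hadd a ha b hb) h0
      fun b hb => hsmul _ (hc b hb) _ (htQ hb)
  refine ⟨∑ b ∈ t, (1 : ℝ) • b, hsum _ fun _ _ => zero_le_one, fun z hz => ?_⟩
  rw [ht] at hz
  obtain ⟨c, -, rfl⟩ := Submodule.mem_span_finset.1 hz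
  have hpos : 0 < 1 + ∑ b ∈ t, |c b| := by positivity
  refine ⟨(1 + ∑ b ∈ t, |c b|)⁻¹, inv_pos.2 hpos, ?_⟩
  rw [Finset.smul_sum, ← Finset.sum_sub_distrib]
  simp_rw [smul_smul, ← sub_smul]
  refine hsum _ fun b hb => ?_
  rw [sub_nonneg, inv_mul_le_iff₀ hpos, mul_one]
  have := Finset.single_le_sum (f := fun b => |c b|) (fun i _ => abs_nonneg _) hb
  linarith [le_abs_self (c b)]

section Abstract

variable {V : Type*} [NormedAddCommGroup V] [NormedSpace ℝ V]

/-- In a salient closed cone, a half-line pointing in the direction `-e` is bounded. -/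
theorem IsClosedCone.exists_bound {K : Set V} (hK : IsClosedCone K)
    (hsal : ∀ x ∈ K, -x ∈ K → x = 0) {e : V} (he : e ∈ K) (he0 : e ≠ 0) (y : V) :
    ∃ R : ℝ, ∀ r, y - r • e ∈ K → r ≤ R := by
  by_contra! h
  refine he0 (hsal e he ?_)
  choose r hr hrR using h
  have hr' : Filter.Tendsto (fun n : ℕ => r n) Filter.atTop Filter.atTop :=
    Filter.tendsto_atTop_mono (fun n => (hrR n).le) tendsto_natCast_atTop_atTop
  have hlim : Filter.Tendsto (fun n : ℕ => (r n)⁻¹ • (y - r n • e)) Filter.atTop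
      (nhds (-e)) := by
    have h1 : Filter.Tendsto (fun n : ℕ => (r n)⁻¹ • y - e) Filter.atTop
        (nhds ((0 : ℝ) • y - e)) :=
      ((tendsto_inv_atTop_zero.comp hr').smul_const y).sub_const e
    rw [zero_smul, zero_sub] at h1
    refine h1.congr' ?_
    filter_upwards [hr'.eventually_gt_atTop 0] with n hn
    rw [smul_sub, smul_smul, inv_mul_cancel₀ hn.ne', one_smul]
  refine hK.isClosed.mem_of_tendsto hlim ?_
  filter_upwards [hr'.eventually_gt_atTop 0] with n hn
  exact hK.smul_mem _ (inv_nonneg.2 hn.le) _ (hr n)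

variable [FiniteDimensional ℝ V]

/-- A non-zero salient closed cone that is preserved by a family of linear maps contains a
minimal such cone. -/
theorem exists_minimal_cone {K : Set V} (hK : IsClosedCone K)
    (hne : ∃ x ∈ K, x ≠ 0) (𝒢 : Set (Module.End ℝ V)) (hinv : ∀ g ∈ 𝒢, ∀ x ∈ K, g x ∈ K) :
    ∃ N ⊆ K, IsClosedCone N ∧ (∀ g ∈ 𝒢, ∀ x ∈ N, g x ∈ N) ∧ (∃ x ∈ N, x ≠ 0) ∧
      ∀ M ⊆ N, IsClosedCone M → (∀ g ∈ 𝒢, ∀ x ∈ M, g x ∈ M) → (∃ x ∈ M, x ≠ 0) → M = N := by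
  have : ProperSpace V := FiniteDimensional.proper_real V
  have hn : ∀ M : Set V, IsClosedCone M → ∀ x ≠ 0, (‖x‖⁻¹ • x ∈ M ↔ x ∈ M) := by
    intro M hM x hx
    refine ⟨fun h => ?_, fun h => hM.smul_mem _ (by positivity) _ h⟩
    have := hM.smul_mem ‖x‖ (norm_nonneg x) _ h
    rwa [smul_smul, mul_inv_cancel₀ (norm_ne_zero_iff.2 hx), one_smul] at this
  have hsph : ∀ x : V, x ≠ 0 → ‖x‖⁻¹ • x ∈ Metric.sphere (0 : V) 1 := fun x hx => by
    simp [norm_smul, hx]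
  let P : Set (Metric.sphere (0 : V) 1) → Prop := fun B =>
    ∃ N : Set V, IsClosedCone N ∧ (∀ g ∈ 𝒢, ∀ x ∈ N, g x ∈ N) ∧ B = Subtype.val ⁻¹' N
  obtain ⟨x₀, hx₀, hx₀'⟩ := hne
  obtain ⟨B, ⟨N, hN, hNinv, rfl⟩, ⟨x, hx⟩, hBK, hmin⟩ := exists_minimal_nonempty_of_isClosed P
    (by rintro B ⟨N, hN, -, rfl⟩; exact hN.isClosed.preimage continuous_subtype_val)
    (by
      intro c hc h
      choose! F hF1 hF2 hF3 using h
      refine ⟨⋂ B ∈ c, F B, ⟨isClosed_biInter fun B hB => (hF1 B hB).isClosed, ?_, ?_, ?_⟩, ?_, ?_⟩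
      · exact Set.mem_iInter₂.2 fun B hB => (hF1 B hB).zero_mem
      · exact fun x hx y hy => Set.mem_iInter₂.2 fun B hB =>
          (hF1 B hB).add_mem x (Set.mem_iInter₂.1 hx B hB) y (Set.mem_iInter₂.1 hy B hB)
      · exact fun r hr x hx => Set.mem_iInter₂.2 fun B hB =>
          (hF1 B hB).smul_mem r hr x (Set.mem_iInter₂.1 hx B hB)
      · exact fun g hg x hx => Set.mem_iInter₂.2 fun B hB =>
          hF2 B hB g hg x (Set.mem_iInter₂.1 hx B hB)
      · rw [Set.preimage_iInter₂, Set.sInter_eq_biInter]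
        exact Set.iInter₂_congr hF3)
    (B₀ := Subtype.val ⁻¹' K) ⟨K, hK, hinv, rfl⟩
    ⟨⟨_, hsph x₀ hx₀'⟩, (hn K hK x₀ hx₀').2 hx₀⟩
  have hsub : ∀ M M' : Set V, IsClosedCone M → IsClosedCone M' →
      (Subtype.val ⁻¹' M : Set (Metric.sphere (0 : V) 1)) ⊆ Subtype.val ⁻¹' M' → M ⊆ M' := by
    intro M M' hM hM' h y hy
    rcases eq_or_ne y 0 with rfl | hy0
    · exact hM'.zero_mem
    · exact (hn M' hM' y hy0).1 (@h ⟨_, hsph y hy0⟩ ((hn M hM y hy0).2 hy))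
  refine ⟨N, hsub N K hN hK hBK, hN, hNinv, ⟨x, hx, ?_⟩, ?_⟩
  · exact ne_zero_of_mem_unit_sphere x
  · rintro M hMN hM hMinv ⟨y, hy, hy0⟩
    refine hMN.antisymm (hsub N M hN hM ?_)
    exact (hmin _ ⟨M, hM, hMinv, rfl⟩ ⟨⟨_, hsph y hy0⟩, (hn M hM y hy0).2 hy⟩
      (Set.preimage_mono hMN)).ge

/-- Commuting linear maps preserving a non-zero salient closed cone have a common eigenvector in
it. On a minimal invariant cone `N`, each of the maps `g` is a scalar: for the largest `r` with
`(g - r) N ⊆ N`, the cone `(g - r) N` is zero or dense in `N`, and in the second case `r` could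
be increased. -/
theorem exists_common_eigenvector {K : Set V} (hK : IsClosedCone K)
    (hsal : ∀ x ∈ K, -x ∈ K → x = 0) (hne : ∃ x ∈ K, x ≠ 0) {𝒢 : Set (Module.End ℝ V)}
    (hcomm : ∀ a ∈ 𝒢, ∀ b ∈ 𝒢, ∀ x, a (b x) = b (a x)) (hinv : ∀ g ∈ 𝒢, ∀ x ∈ K, g x ∈ K) :
    ∃ e ∈ K, e ≠ 0 ∧ ∀ g ∈ 𝒢, ∃ r : ℝ, 0 ≤ r ∧ g e = r • e := by
  obtain ⟨N, hNK, hN, hNinv, ⟨e, heN, he0⟩, hmin⟩ := exists_minimal_cone hK hne 𝒢 hinv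
  have hNsal : ∀ x ∈ N, -x ∈ N → x = 0 := fun x hx hx' => hsal x (hNK hx) (hNK hx')
  refine ⟨e, hNK heN, he0, fun g hg => ?_⟩
  -- the set of all `r` with `(g - r) N ⊆ N`
  let A : Set ℝ := {r | 0 ≤ r ∧ ∀ x ∈ N, g x - r • x ∈ N}
  have hA0 : (0 : ℝ) ∈ A := ⟨le_rfl, fun x hx => by simpa using hNinv g hg x hx⟩
  have hAcl : IsClosed A := by
    have : A = Set.Ici 0 ∩ ⋂ x ∈ N, {r : ℝ | g x - r • x ∈ N} := by
      ext r; simp [A]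
    rw [this]
    exact isClosed_Ici.inter (isClosed_biInter fun x _ =>
      hN.isClosed.preimage (by fun_prop))
  have hAbdd : BddAbove A := by
    obtain ⟨R, hR⟩ := hN.exists_bound hNsal heN he0 (g e)
    exact ⟨R, fun r hr => hR r (hr.2 e heN)⟩
  set r := sSup A
  have hrA : r ∈ A := hAcl.csSup_mem ⟨0, hA0⟩ hAbdd
  refine ⟨r, hrA.1, ?_⟩
  by_contra hge
  let T : Module.End ℝ V := g - r • 1
  have hT : ∀ x, T x = g x - r • x := fun x => by simp [T]
  have hTcomm : ∀ h ∈ 𝒢, ∀ x, T (h x) = h (T x) := fun h hh x => by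
    rw [hT, hT, hcomm g hg h hh, map_sub, map_smul]
  have hTN : ∀ x ∈ N, T x ∈ N := fun x hx => by rw [hT]; exact hrA.2 x hx
  -- the invariant cone `closure (T N)` is all of `N`
  have hcl : closure (T '' N) = N := by
    refine hmin _ (closure_minimal (by rintro _ ⟨x, hx, rfl⟩; exact hTN x hx) hN.isClosed)
      ⟨isClosed_closure, subset_closure ⟨0, hN.zero_mem, map_zero T⟩, ?_, ?_⟩ ?_
      ⟨T e, subset_closure ⟨e, heN, rfl⟩, ?_⟩
    · intro x hx y hy
      refine map_mem_closure₂ continuous_add hx hy ?_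
      rintro _ ⟨x, hx, rfl⟩ _ ⟨y, hy, rfl⟩
      exact ⟨x + y, hN.add_mem x hx y hy, map_add T x y⟩
    · intro c hc x hx
      refine map_mem_closure (continuous_const_smul c) hx ?_
      rintro _ ⟨x, hx, rfl⟩
      exact ⟨c • x, hN.smul_mem c hc x hx, map_smul T c x⟩
    · intro h hh x hx
      refine map_mem_closure (LinearMap.continuous_of_finiteDimensional h) hx ?_
      rintro _ ⟨x, hx, rfl⟩
      exact ⟨h x, hNinv h hh x hx, hTcomm h hh x⟩
    · rw [hT]; exact sub_ne_zero.2 hge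
  have hspan : N ⊆ (Submodule.span ℝ (T '' N) : Set V) := by
    rw [← hcl]
    refine closure_minimal (by rw [hcl]; exact Submodule.subset_span) ?_
    exact Submodule.closed_of_finiteDimensional _
  obtain ⟨q, ⟨x, hx, rfl⟩, hq⟩ := exists_internal_point (Q := T '' N)
    ⟨0, hN.zero_mem, map_zero T⟩
    (by
      rintro _ ⟨x, hx, rfl⟩ _ ⟨y, hy, rfl⟩
      exact ⟨x + y, hN.add_mem x hx y hy, map_add T x y⟩)
    (by
      rintro c hc _ ⟨x, hx, rfl⟩
      exact ⟨c • x, hN.smul_mem c hc x hx, map_smul T c x⟩)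
  obtain ⟨ε, hε, y, hy, hyx⟩ := hq x (hspan hx)
  have hTe : T e ≠ 0 := by rw [hT]; exact sub_ne_zero.2 hge
  have hx0 : x ≠ 0 := by
    rintro rfl
    obtain ⟨δ, hδ, z, hz, hzx⟩ := hq (T e) (Submodule.subset_span ⟨e, heN, rfl⟩)
    rw [map_zero, zero_sub] at hzx
    refine hTe (hNsal _ (hTN e heN) ?_)
    have := hN.smul_mem δ⁻¹ (by positivity) _ (hTN z hz)
    rwa [hzx, smul_neg, smul_smul, inv_mul_cancel₀ hδ.ne', one_smul] at this
  -- hence `r` can be increased by `ε`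
  have hNε : {z ∈ N | T z - ε • z ∈ N} = N := by
    refine hmin _ (fun z hz => hz.1) ⟨?_, ⟨hN.zero_mem, by simpa using hN.zero_mem⟩, ?_, ?_⟩ ?_
      ⟨x, ⟨hx, hyx ▸ hTN y hy⟩, hx0⟩
    · have : Continuous T := LinearMap.continuous_of_finiteDimensional T
      exact hN.isClosed.inter (hN.isClosed.preimage (by fun_prop))
    · rintro a ⟨ha, ha'⟩ b ⟨hb, hb'⟩
      refine ⟨hN.add_mem a ha b hb, ?_⟩
      have := hN.add_mem _ ha' _ hb'
      rwa [show T (a + b) - ε • (a + b) = T a - ε • a + (T b - ε • b) by rw [map_add]; module]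
    · rintro c hc a ⟨ha, ha'⟩
      refine ⟨hN.smul_mem c hc a ha, ?_⟩
      have := hN.smul_mem c hc _ ha'
      rwa [map_smul, smul_comm ε c, ← smul_sub]
    · rintro h hh a ⟨ha, ha'⟩
      refine ⟨hNinv h hh a ha, ?_⟩
      have := hNinv h hh _ ha'
      rwa [map_sub, map_smul, ← hTcomm h hh] at this
  have : r + ε ∈ A := by
    refine ⟨add_nonneg hrA.1 hε.le, fun z hz => ?_⟩
    have h2 : z ∈ {z ∈ N | T z - ε • z ∈ N} := by rwa [hNε]
    have h3 := h2.2
    rwa [hT, sub_sub, ← add_smul] at h3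
  linarith [le_csSup hAbdd this]

end Abstract

/-! ### Minimal cones are simplicial -/

/-- If commuting linear maps have a common eigenvector, then so do their transposes, with the same
eigenvalues. With `I` the ideal generated by the `g - μ g` in the commutative algebra generated by
the maps, Nakayama's lemma shows `I • V ≠ V`, because `I` kills the eigenvector. -/
theorem exists_dual_eigenvector {V : Type*} [AddCommGroup V] [Module ℝ V] [FiniteDimensional ℝ V]
    {𝒢 : Set (Module.End ℝ V)} (hcomm : ∀ a ∈ 𝒢, ∀ b ∈ 𝒢, ∀ x, a (b x) = b (a x))
    {e : V} (he0 : e ≠ 0) {μ : Module.End ℝ V → ℝ} (he : ∀ g ∈ 𝒢, g e = μ g • e) :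
    ∃ f : Module.Dual ℝ V, f ≠ 0 ∧ ∀ g ∈ 𝒢, ∀ x, f (g x) = μ g * f x := by
  have hc : IsMulCommutative (Algebra.adjoin ℝ 𝒢) :=
    Algebra.isMulCommutative_adjoin ℝ fun a ha b hb => LinearMap.ext (hcomm a ha b hb)
  let A := Algebra.adjoin ℝ 𝒢
  let _ : CommRing A := { (inferInstance : Ring A) with mul_comm := fun a b => hc.is_comm.comm a b }
  let I : Ideal A := Ideal.span {a | ∃ g ∈ 𝒢, (a : Module.End ℝ V) = g - μ g • 1}
  have hIe : ∀ a ∈ I, a • e = 0 := by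
    intro a ha
    induction ha using Submodule.span_induction with
    | mem a ha =>
      obtain ⟨g, hg, hag⟩ := ha
      rw [Subalgebra.smul_def, hag]
      simp [he g hg]
    | zero => simp
    | add a b _ _ ha hb => rw [add_smul, ha, hb, add_zero]
    | smul a b _ hb => rw [smul_eq_mul, mul_smul, hb, smul_zero]
  have : Module.Finite A V := Module.Finite.of_restrictScalars_finite ℝ A V
  have hIV : I • (⊤ : Submodule A V) ≠ ⊤ := by
    intro h
    obtain ⟨r, hr, hr0⟩ := Submodule.exists_sub_one_mem_and_smul_eq_zero_of_fg_of_le_smul I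
      (⊤ : Submodule A V) Module.Finite.fg_top h.ge
    have h1 := hIe _ hr
    rw [sub_smul, hr0 e trivial, one_smul, zero_sub, neg_eq_zero] at h1
    exact he0 h1
  obtain ⟨f, hf0, hf⟩ := Submodule.exists_le_ker_of_lt_top
    ((I • (⊤ : Submodule A V)).restrictScalars ℝ) (lt_top_iff_ne_top.2 fun h => hIV (by
      rwa [Submodule.restrictScalars_eq_top_iff] at h))
  refine ⟨f, hf0, fun g hg x => ?_⟩
  have hgA : g - μ g • 1 ∈ Algebra.adjoin ℝ 𝒢 :=
    sub_mem (Algebra.subset_adjoin hg) (Subalgebra.smul_mem _ (one_mem _) _)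
  have h2 : (⟨_, hgA⟩ : A) • x ∈ I • (⊤ : Submodule A V) :=
    Submodule.smul_mem_smul (Ideal.subset_span ⟨g, hg, rfl⟩) trivial
  have h3 : f (g x - μ g • x) = 0 := by
    have := hf h2
    simpa [Subalgebra.smul_def] using this
  rw [map_sub, map_smul, smul_eq_mul] at h3
  linarith

/-- The situation of a minimal invariant convex set, seen from the cones: `K` is a salient
generating closed cone preserved by the commuting linear maps `𝒢`, and `D` is a non-empty convex
subcone absorbing addition of elements of `K`, such that `K` is the only invariant
closed subcone of `K` that meets `D`. -/
structure IsMinimalCone {V : Type*} [AddCommGroup V] [Module ℝ V] [TopologicalSpace V]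
    (𝒢 : Set (Module.End ℝ V)) (K D : Set V) : Prop where
  cone : IsClosedCone K
  salient : ∀ x ∈ K, -x ∈ K → x = 0
  span_eq_top : Submodule.span ℝ K = ⊤
  comm : ∀ a ∈ 𝒢, ∀ b ∈ 𝒢, ∀ x, a (b x) = b (a x)
  map_mem : ∀ g ∈ 𝒢, ∀ x ∈ K, g x ∈ K
  nonempty : D.Nonempty
  subset : D ⊆ K
  add_mem : ∀ x ∈ D, ∀ y ∈ K, x + y ∈ D
  smul_mem : ∀ c : ℝ, 0 < c → ∀ x ∈ D, c • x ∈ D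
  eq_of_meets : ∀ N ⊆ K, IsClosedCone N → (∀ g ∈ 𝒢, ∀ x ∈ N, g x ∈ N) →
    (∃ x ∈ D, x ∈ N) → N = K

namespace IsMinimalCone

variable {V : Type*} [NormedAddCommGroup V] [NormedSpace ℝ V] [FiniteDimensional ℝ V]
  {𝒢 : Set (Module.End ℝ V)} {K D : Set V}

omit [FiniteDimensional ℝ V] in
theorem eigenvalue_nonneg (h : IsMinimalCone 𝒢 K D) {e : V} (heK : e ∈ K) (he0 : e ≠ 0)
    {g : Module.End ℝ V} (hg : g ∈ 𝒢) {r : ℝ} (hr : g e = r • e) : 0 ≤ r := by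
  by_contra! hlt
  refine he0 (h.salient e heK ?_)
  have := h.cone.smul_mem (-r)⁻¹ (inv_nonneg.2 (by linarith)) _ (h.map_mem g hg e heK)
  rwa [hr, smul_smul, inv_neg, neg_mul, inv_mul_cancel₀ hlt.ne, neg_one_smul] at this

/-- By minimality, a common eigenvector of the transposes that vanishes at a point of `D`
vanishes on `K`, hence everywhere. -/
theorem eq_zero_of_eq_zero (h : IsMinimalCone 𝒢 K D) {f : Module.Dual ℝ V}
    {μ : Module.End ℝ V → ℝ} (hf : ∀ g ∈ 𝒢, ∀ x, f (g x) = μ g * f x) {x : V} (hx : x ∈ D)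
    (hfx : f x = 0) : f = 0 := by
  have hfc : Continuous f := LinearMap.continuous_of_finiteDimensional f
  have hN : {x ∈ K | f x = 0} = K := by
    refine h.eq_of_meets _ (fun z hz => hz.1)
      ⟨h.cone.isClosed.inter (isClosed_eq hfc continuous_const),
        ⟨h.cone.zero_mem, map_zero f⟩, ?_, ?_⟩ ?_ ⟨x, hx, h.subset hx, hfx⟩
    · rintro a ⟨ha, ha'⟩ b ⟨hb, hb'⟩
      exact ⟨h.cone.add_mem a ha b hb, by rw [map_add, ha', hb', add_zero]⟩
    · rintro c hc a ⟨ha, ha'⟩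
      exact ⟨h.cone.smul_mem c hc a ha, by rw [map_smul, ha', smul_zero]⟩
    · rintro g hg a ⟨ha, ha'⟩
      exact ⟨h.map_mem g hg a ha, by rw [hf g hg, ha', mul_zero]⟩
  refine LinearMap.ext_on h.span_eq_top fun z hz => ?_
  rw [← hN] at hz
  exact hz.2

/-- Up to sign, a common eigenvector of the transposes with non-negative eigenvalues is
positive on `D`. -/
theorem exists_pos_dual_eigenvector (h : IsMinimalCone 𝒢 K D) {e : V} (heK : e ∈ K) (he0 : e ≠ 0)
    {μ : Module.End ℝ V → ℝ} (he : ∀ g ∈ 𝒢, g e = μ g • e) :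
    ∃ f : Module.Dual ℝ V, (∀ g ∈ 𝒢, ∀ x, f (g x) = μ g * f x) ∧ (∀ x ∈ K, 0 ≤ f x) ∧
      ∀ x ∈ D, 0 < f x := by
  have key : ∀ f : Module.Dual ℝ V, (∀ g ∈ 𝒢, ∀ x, f (g x) = μ g * f x) →
      (∃ x ∈ D, 0 ≤ f x) → ∀ x ∈ K, 0 ≤ f x := by
    rintro f hf ⟨x, hx, hfx⟩
    have hfc : Continuous f := LinearMap.continuous_of_finiteDimensional f
    have hN : {x ∈ K | 0 ≤ f x} = K := by
      refine h.eq_of_meets _ (fun z hz => hz.1)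
        ⟨h.cone.isClosed.inter (isClosed_le continuous_const hfc),
          ⟨h.cone.zero_mem, (map_zero f).ge⟩, ?_, ?_⟩ ?_ ⟨x, hx, h.subset hx, hfx⟩
      · rintro a ⟨ha, ha'⟩ b ⟨hb, hb'⟩
        exact ⟨h.cone.add_mem a ha b hb, by rw [map_add]; exact add_nonneg ha' hb'⟩
      · rintro c hc a ⟨ha, ha'⟩
        exact ⟨h.cone.smul_mem c hc a ha, by rw [map_smul]; exact mul_nonneg hc ha'⟩
      · rintro g hg a ⟨ha, ha'⟩
        exact ⟨h.map_mem g hg a ha, by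
          rw [hf g hg]; exact mul_nonneg (h.eigenvalue_nonneg heK he0 hg (he g hg)) ha'⟩
    intro z hz
    rw [← hN] at hz
    exact hz.2
  have main : ∀ f : Module.Dual ℝ V, f ≠ 0 → (∀ g ∈ 𝒢, ∀ x, f (g x) = μ g * f x) →
      (∃ x ∈ D, 0 ≤ f x) → ∃ f : Module.Dual ℝ V, (∀ g ∈ 𝒢, ∀ x, f (g x) = μ g * f x) ∧
      (∀ x ∈ K, 0 ≤ f x) ∧ ∀ x ∈ D, 0 < f x := fun f hf0 hf hx =>
    ⟨f, hf, key f hf hx, fun z hz => (key f hf hx z (h.subset hz)).lt_of_ne fun hfz =>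
      hf0 (h.eq_zero_of_eq_zero hf hz hfz.symm)⟩
  obtain ⟨f, hf0, hf⟩ := exists_dual_eigenvector h.comm he0 he
  obtain ⟨x, hx⟩ := h.nonempty
  rcases le_total 0 (f x) with hfx | hfx
  · exact main f hf0 hf ⟨x, hx, hfx⟩
  · exact main (-f) (neg_ne_zero.2 hf0) (fun g hg y => by simp [hf g hg y])
      ⟨x, hx, by simpa using hfx⟩

/-- Positive common eigenvectors of the transposes with the same eigenvalues are proportional. -/
theorem exists_eq_smul (h : IsMinimalCone 𝒢 K D) {f₁ f₂ : Module.Dual ℝ V}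
    {μ : Module.End ℝ V → ℝ} (hf₁ : ∀ g ∈ 𝒢, ∀ x, f₁ (g x) = μ g * f₁ x)
    (hf₂ : ∀ g ∈ 𝒢, ∀ x, f₂ (g x) = μ g * f₂ x) (hpos : ∀ x ∈ D, 0 < f₂ x) :
    ∃ c : ℝ, f₁ = c • f₂ := by
  obtain ⟨x, hx⟩ := h.nonempty
  refine ⟨f₁ x / f₂ x, sub_eq_zero.1 (h.eq_zero_of_eq_zero (μ := μ) (fun g hg y => ?_) hx ?_)⟩
  · simp [hf₁ g hg y, hf₂ g hg y]; ring
  · have := (hpos x hx).ne'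
    simp [this]

/-- For a common eigenvector `e` in `K` there is a non-negative common eigenvector `f` of the
transposes with the same eigenvalues and `f e = 1`, and the projection along `e` onto the kernel
of `f` preserves `K`. -/
theorem exists_projection (h : IsMinimalCone 𝒢 K D) {e : V} (heK : e ∈ K) (he0 : e ≠ 0)
    {μ : Module.End ℝ V → ℝ} (he : ∀ g ∈ 𝒢, g e = μ g • e) :
    ∃ f : Module.Dual ℝ V, (∀ g ∈ 𝒢, ∀ x, f (g x) = μ g * f x) ∧ (∀ x ∈ K, 0 ≤ f x) ∧
      (∀ x ∈ D, 0 < f x) ∧ f e = 1 ∧ ∀ x ∈ K, x - f x • e ∈ K := by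
  obtain ⟨f, hf, hfK, hfD⟩ := h.exists_pos_dual_eigenvector heK he0 he
  obtain ⟨x₀, hx₀⟩ := h.nonempty
  -- the set of all `s` for which `x ↦ x - s f(x) e` preserves `K`
  let A : Set ℝ := {s | ∀ x ∈ K, x - (s * f x) • e ∈ K}
  have hAcl : IsClosed A := by
    have : A = ⋂ x ∈ K, {s : ℝ | x - (s * f x) • e ∈ K} := by ext s; simp [A]
    rw [this]
    exact isClosed_biInter fun x _ => h.cone.isClosed.preimage (by fun_prop)
  have hA0 : (0 : ℝ) ∈ A := fun x hx => by simpa using hx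
  have hAbdd : BddAbove A := by
    obtain ⟨R, hR⟩ := h.cone.exists_bound h.salient heK he0 x₀
    refine ⟨R / f x₀, fun s hs => ?_⟩
    rw [le_div_iff₀ (hfD x₀ hx₀)]
    exact hR _ (hs x₀ (h.subset hx₀))
  have hApos : ∃ s ∈ A, 0 < s := by
    obtain ⟨q, hqK, hq⟩ := exists_internal_point h.cone.zero_mem h.cone.add_mem h.cone.smul_mem
    obtain ⟨ε, hε, hεK⟩ := hq e (h.span_eq_top ▸ trivial)
    have hxD : x₀ + q ∈ D := h.add_mem x₀ hx₀ q hqK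
    have hfx := hfD _ hxD
    refine ⟨ε / f (x₀ + q), ?_, by positivity⟩
    set s := ε / f (x₀ + q) with hs
    have hfc : Continuous f := LinearMap.continuous_of_finiteDimensional f
    have hN : {x ∈ K | x - (s * f x) • e ∈ K} = K := by
      refine h.eq_of_meets _ (fun z hz => hz.1)
        ⟨h.cone.isClosed.inter (h.cone.isClosed.preimage (by fun_prop)),
          ⟨h.cone.zero_mem, by simpa using h.cone.zero_mem⟩, ?_, ?_⟩ ?_
          ⟨x₀ + q, hxD, h.subset hxD, ?_⟩
      · rintro a ⟨ha, ha'⟩ b ⟨hb, hb'⟩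
        refine ⟨h.cone.add_mem a ha b hb, ?_⟩
        have := h.cone.add_mem _ ha' _ hb'
        rwa [show a + b - (s * f (a + b)) • e = a - (s * f a) • e + (b - (s * f b) • e) by
          rw [map_add]; module]
      · rintro c hc a ⟨ha, ha'⟩
        refine ⟨h.cone.smul_mem c hc a ha, ?_⟩
        have := h.cone.smul_mem c hc _ ha'
        rwa [show c • a - (s * f (c • a)) • e = c • (a - (s * f a) • e) by
          rw [map_smul, smul_eq_mul]; module]
      · rintro g hg a ⟨ha, ha'⟩
        refine ⟨h.map_mem g hg a ha, ?_⟩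
        have := h.map_mem g hg _ ha'
        rw [map_sub, map_smul, he g hg] at this
        rwa [show g a - (s * f (g a)) • e = g a - (s * f a) • μ g • e by
          rw [hf g hg]; module]
      · rw [show x₀ + q - (s * f (x₀ + q)) • e = x₀ + (q - ε • e) by
          rw [hs, div_mul_cancel₀ _ hfx.ne']; module]
        exact h.cone.add_mem _ (h.subset hx₀) _ hεK
    intro z hz
    rw [← hN] at hz
    exact hz.2
  -- composing the maps for `s` and `t` gives the map for `s + t - s t f(e)`
  have hAmul : ∀ s ∈ A, ∀ t ∈ A, s + t - s * t * f e ∈ A := by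
    intro s hs t ht x hx
    have := hs _ (ht x hx)
    rwa [map_sub, map_smul, smul_eq_mul, sub_sub, ← add_smul,
      show t * f x + s * (f x - t * f x * f e) = (s + t - s * t * f e) * f x by ring] at this
  set s := sSup A
  have hsA : s ∈ A := hAcl.csSup_mem ⟨0, hA0⟩ hAbdd
  have hs0 : 0 < s := by
    obtain ⟨t, ht, ht0⟩ := hApos
    exact ht0.trans_le (le_csSup hAbdd ht)
  have hse : 1 ≤ s * f e := by
    have := le_csSup hAbdd (hAmul s hsA s hsA)
    change s + s - s * s * f e ≤ s at this
    by_contra! hlt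
    nlinarith
  have hfe : 0 < f e := by
    by_contra! hle
    nlinarith
  have hA1 : (f e)⁻¹ ∈ A := by
    intro x hx
    have h1 : 0 ≤ 1 - (s * f e)⁻¹ := sub_nonneg.2 (inv_le_one_of_one_le₀ hse)
    have h2 := h.cone.add_mem _ (h.cone.smul_mem _ h1 x hx) _
      (h.cone.smul_mem (s * f e)⁻¹ (by positivity) _ (hsA x hx))
    rw [show (f e)⁻¹ = (s * f e)⁻¹ * s by field_simp]
    convert h2 using 1
    module
  refine ⟨(f e)⁻¹ • f, fun g hg x => ?_, fun x hx => ?_, fun x hx => ?_, ?_, fun x hx => hA1 x hx⟩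
  · simp [hf g hg x]; ring
  · exact mul_nonneg (inv_nonneg.2 hfe.le) (hfK x hx)
  · exact mul_pos (inv_pos.2 hfe) (hfD x hx)
  · simp [hfe.ne']

/-- A family of common eigenvectors `e i ∈ K` with dual common eigenvectors `f i` of the
transposes, such that projecting the `e i` away preserves `K`. -/
structure EigenSystem (𝒢 : Set (Module.End ℝ V)) (K D : Set V) {n : ℕ} (e : Fin n → V)
    (f : Fin n → Module.Dual ℝ V) : Prop where
  mem : ∀ i, e i ∈ K
  dual : ∀ i j, f i (e j) = if i = j then 1 else 0
  eigen : ∀ i, ∃ μ : Module.End ℝ V → ℝ, ∀ g ∈ 𝒢, g (e i) = μ g • e i ∧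
    ∀ x, f i (g x) = μ g * f i x
  nonneg : ∀ i, ∀ x ∈ K, 0 ≤ f i x
  pos : ∀ i, ∀ x ∈ D, 0 < f i x
  proj_mem : ∀ x ∈ K, x - ∑ i, f i x • e i ∈ K

omit [FiniteDimensional ℝ V] in
theorem EigenSystem.linearIndependent {n : ℕ} {e : Fin n → V} {f : Fin n → Module.Dual ℝ V}
    (s : EigenSystem 𝒢 K D e f) : LinearIndependent ℝ e := by
  rw [Fintype.linearIndependent_iff]
  intro c hc i
  have := congrArg (f i) hc
  simpa [s.dual] using this

/-- An eigensystem that does not span is enlarged by a common eigenvector in the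
part of `K` on which its functionals vanish. -/
theorem EigenSystem.extend (h : IsMinimalCone 𝒢 K D) {n : ℕ} {e : Fin n → V}
    {f : Fin n → Module.Dual ℝ V} (s : EigenSystem 𝒢 K D e f)
    (hs : ¬ ∀ x, ∑ i, f i x • e i = x) :
    ∃ (e' : Fin (n + 1) → V) (f' : Fin (n + 1) → Module.Dual ℝ V), EigenSystem 𝒢 K D e' f' := by
  have hfc : ∀ i, Continuous (f i) := fun i => LinearMap.continuous_of_finiteDimensional (f i)
  let N : Set V := {x ∈ K | ∀ i, f i x = 0}
  have hN : IsClosedCone N := by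
    refine ⟨?_, ⟨h.cone.zero_mem, fun i => map_zero _⟩, ?_, ?_⟩
    · have : N = K ∩ ⋂ i, {x | f i x = 0} := by ext x; simp [N]
      rw [this]
      exact h.cone.isClosed.inter (isClosed_iInter fun i => isClosed_eq (hfc i) continuous_const)
    · rintro a ⟨ha, ha'⟩ b ⟨hb, hb'⟩
      exact ⟨h.cone.add_mem a ha b hb, fun i => by rw [map_add, ha', hb', add_zero]⟩
    · rintro c hc a ⟨ha, ha'⟩
      exact ⟨h.cone.smul_mem c hc a ha, fun i => by rw [map_smul, ha', smul_zero]⟩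
  have hNne : ∃ x ∈ N, x ≠ 0 := by
    by_contra! hN0
    refine hs fun x => ?_
    have : ∑ i, (f i).smulRight (e i) = LinearMap.id (R := ℝ) (M := V) := by
      refine LinearMap.ext_on h.span_eq_top fun z hz => ?_
      have h1 := hN0 (z - ∑ i, f i z • e i) ⟨s.proj_mem z hz, fun i => by simp [s.dual]⟩
      simpa using (sub_eq_zero.1 h1).symm
    simpa using LinearMap.congr_fun this x
  obtain ⟨v, ⟨hvK, hvf⟩, hv0, hv⟩ := exists_common_eigenvector hN
    (fun x hx hx' => h.salient x hx.1 hx'.1) hNne h.comm (by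
      rintro g hg x ⟨hx, hx'⟩
      refine ⟨h.map_mem g hg x hx, fun i => ?_⟩
      obtain ⟨μ, hμ⟩ := s.eigen i
      rw [(hμ g hg).2, hx', mul_zero])
  choose! μ _ hμ using hv
  obtain ⟨p, hp, hpK, hpD, hpv, hproj⟩ := h.exists_projection hvK hv0 hμ
  -- a functional with `p (e i) ≠ 0` has the weight of `f i`, so is proportional to it
  have hpe : ∀ i, p (e i) = 0 := by
    intro i
    by_contra hne
    obtain ⟨ν, hν⟩ := s.eigen i
    have hμν : ∀ g ∈ 𝒢, μ g = ν g := fun g hg => by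
      have h1 := hp g hg (e i)
      rw [(hν g hg).1, map_smul, smul_eq_mul] at h1
      exact (mul_right_cancel₀ hne h1).symm
    obtain ⟨c, rfl⟩ := h.exists_eq_smul hp (f₂ := f i)
      (fun g hg x => by rw [(hν g hg).2, hμν g hg]) (s.pos i)
    simp [hvf] at hpv
  refine ⟨Fin.cons v e, Fin.cons p f, ⟨?_, ?_, ?_, ?_, ?_, ?_⟩⟩
  · exact Fin.cases hvK s.mem
  · refine Fin.cases (Fin.cases (by simpa using hpv) fun j => ?_) fun i => Fin.cases ?_ fun j => ?_
    · simp [hpe, (Fin.succ_ne_zero j).symm]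
    · simp [hvf]
    · simp [s.dual]
  · exact Fin.cases ⟨μ, fun g hg => ⟨hμ g hg, hp g hg⟩⟩ s.eigen
  · exact Fin.cases hpK s.nonneg
  · exact Fin.cases hpD s.pos
  · intro x hx
    have h1 := hproj _ (s.proj_mem x hx)
    rw [map_sub, map_sum] at h1
    simp only [map_smul, hpe, smul_zero, Finset.sum_const_zero, sub_zero] at h1
    rw [Fin.sum_univ_succ]
    simp only [Fin.cons_zero, Fin.cons_succ]
    rwa [add_comm, ← sub_sub]

/-- The cone over a minimal invariant convex set is simplicial, spanned by common
eigenvectors, and `D` is its interior. -/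
theorem exists_simplicial (h : IsMinimalCone 𝒢 K D) :
    ∃ (n : ℕ) (e : Fin n → V) (f : Fin n → Module.Dual ℝ V), LinearIndependent ℝ e ∧
      (∀ i j, f i (e j) = if i = j then 1 else 0) ∧
      (∀ x, ∑ i, f i x • e i = x) ∧ (∀ i, ∀ g ∈ 𝒢, ∃ r : ℝ, g (e i) = r • e i) ∧
      ∀ x, x ∈ D ↔ ∀ i, 0 < f i x := by
  obtain ⟨n, e, f, s, hs⟩ : ∃ (n : ℕ) (e : Fin n → V) (f : Fin n → Module.Dual ℝ V),
      EigenSystem 𝒢 K D e f ∧ ∀ x, ∑ i, f i x • e i = x := by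
    by_contra! hno
    have key : ∀ n, ∃ (e : Fin n → V) (f : Fin n → Module.Dual ℝ V), EigenSystem 𝒢 K D e f := by
      intro n
      induction n with
      | zero => exact ⟨Fin.elim0, Fin.elim0, ⟨fun i => i.elim0, fun i => i.elim0, fun i => i.elim0,
          fun i => i.elim0, fun i => i.elim0, fun x hx => by simpa using hx⟩⟩
      | succ n ih =>
        obtain ⟨e, f, s⟩ := ih
        exact s.extend h fun hall => by
          obtain ⟨x, hx⟩ := hno n e f s
          exact hx (hall x)
    obtain ⟨e, f, s⟩ := key (Module.finrank ℝ V + 1)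
    have := s.linearIndependent.fintype_card_le_finrank
    simp at this
  refine ⟨n, e, f, s.linearIndependent, s.dual, hs, fun i g hg => ?_,
    fun x => ⟨fun hx i => s.pos i x hx, fun hx => ?_⟩⟩
  · obtain ⟨μ, hμ⟩ := s.eigen i
    exact ⟨μ g, (hμ g hg).1⟩
  · obtain ⟨y, hy⟩ := h.nonempty
    -- `x - δ y` has non-negative coordinates for small `δ`
    obtain ⟨δ, hδ, hδx⟩ : ∃ δ : ℝ, 0 < δ ∧ ∀ i, δ * f i y ≤ f i x := by
      have hev : ∀ᶠ δ : ℝ in nhdsWithin 0 (Set.Ioi 0), ∀ i, δ * f i y ≤ f i x := by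
        rw [Filter.eventually_all]
        intro i
        have : Filter.Tendsto (fun δ : ℝ => δ * f i y) (nhds 0) (nhds (0 * f i y)) :=
          Filter.tendsto_id.mul_const _
        rw [zero_mul] at this
        exact ((this.eventually (gt_mem_nhds (hx i))).filter_mono nhdsWithin_le_nhds).mono
          fun _ h => h.le
      obtain ⟨δ, h1, h2⟩ := (hev.and self_mem_nhdsWithin).exists
      exact ⟨δ, h2, h1⟩
    have hxy : x - δ • y ∈ K := by
      rw [← hs (x - δ • y)]
      refine Finset.sum_induction _ (· ∈ K) (fun a b ha hb => h.cone.add_mem a ha b hb)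
        h.cone.zero_mem fun i _ => h.cone.smul_mem _ ?_ _ (s.mem i)
      rw [map_sub, map_smul, smul_eq_mul]
      exact sub_nonneg.2 (hδx i)
    have := h.add_mem _ (h.smul_mem δ hδ y hy) _ hxy
    rwa [add_sub_cancel] at this

end IsMinimalCone

variable {d : ℕ}

/-! ### Cones over subsets of projective space -/

/-- The cone over a subset `A` of the affine chart `φ ≠ 0`: of the two opposite half-lines that
lie on a point of `A`, it contains the one where `φ` is positive. -/
def coneOver (φ : Module.Dual ℝ (Fin d → ℝ)) (A : Set (RP d)) : Set (Fin d → ℝ) :=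
  {v | 0 < φ v ∧ ∃ hv : v ≠ 0, Projectivization.mk ℝ v hv ∈ A}

theorem exists_eq_mk (p : RP d) :
    ∃ (v : Fin d → ℝ) (hv : v ≠ 0), p = Projectivization.mk ℝ v hv :=
  ⟨p.rep, p.rep_nonzero, p.mk_rep.symm⟩

theorem mk_smul_eq (v : Fin d → ℝ) {c : ℝ} (hv : v ≠ 0) (hcv : c • v ≠ 0) :
    Projectivization.mk ℝ (c • v) hcv = Projectivization.mk ℝ v hv :=
  (Projectivization.mk_eq_mk_iff' ℝ _ _ _ _).2 ⟨c, rfl⟩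

theorem mk_neg_eq (v : Fin d → ℝ) (hv : v ≠ 0) (hv' : -v ≠ 0) :
    Projectivization.mk ℝ (-v) hv' = Projectivization.mk ℝ v hv :=
  (Projectivization.mk_eq_mk_iff' ℝ _ _ _ _).2 ⟨-1, by simp⟩

section Cone

variable {φ : Module.Dual ℝ (Fin d → ℝ)} {A B : Set (RP d)}

theorem coneOver_mono (h : A ⊆ B) : coneOver φ A ⊆ coneOver φ B :=
  fun _ ⟨h1, h2, h3⟩ => ⟨h1, h2, h h3⟩

theorem smul_mem_coneOver {v : Fin d → ℝ} {c : ℝ} (hc : 0 < c) (hv : v ∈ coneOver φ A) :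
    c • v ∈ coneOver φ A := by
  obtain ⟨h1, h2, h3⟩ := hv
  refine ⟨by rw [map_smul]; exact mul_pos hc h1, smul_ne_zero hc.ne' h2, ?_⟩
  rwa [mk_smul_eq v h2]

theorem mem_coneOver_or_neg_mem (hA : A ⊆ affineChart φ) {v : Fin d → ℝ} (hv : v ≠ 0)
    (hvA : Projectivization.mk ℝ v hv ∈ A) : v ∈ coneOver φ A ∨ -v ∈ coneOver φ A := by
  have h := (mk_mem_affineChart φ v hv).1 (hA hvA)
  rcases h.lt_or_gt with h | h
  · refine Or.inr ⟨by rw [map_neg]; linarith, neg_ne_zero.2 hv, ?_⟩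
    rwa [mk_neg_eq v hv]
  · exact Or.inl ⟨h, hv, hvA⟩

theorem exists_mem_coneOver (hA : A ⊆ affineChart φ) {p : RP d} (hp : p ∈ A) :
    ∃ v ∈ coneOver φ A, ∃ hv : v ≠ 0, Projectivization.mk ℝ v hv = p := by
  obtain ⟨v, hv, rfl⟩ := exists_eq_mk p
  rcases mem_coneOver_or_neg_mem hA hv hp with h | h
  · exact ⟨v, h, hv, rfl⟩
  · exact ⟨-v, h, neg_ne_zero.2 hv, mk_neg_eq v hv _⟩

/-- Two vectors of a cone on the same line differ by a positive factor. -/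
theorem exists_pos_smul_eq {u v : Fin d → ℝ} (hu : u ≠ 0) (hv : v ≠ 0) (hφu : 0 < φ u)
    (hφv : 0 < φ v) (h : Projectivization.mk ℝ u hu = Projectivization.mk ℝ v hv) :
    ∃ c : ℝ, 0 < c ∧ c • v = u := by
  obtain ⟨c, rfl⟩ := (Projectivization.mk_eq_mk_iff' ℝ _ _ _ _).1 h
  rw [map_smul, smul_eq_mul] at hφu
  exact ⟨c, pos_of_mul_pos_left hφu hφv.le, rfl⟩

theorem mem_coneOver_iff {v : Fin d → ℝ} :
    v ∈ coneOver φ A ↔ 0 < φ v ∧ (φ v)⁻¹ • v ∈ affineCoord φ '' A := by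
  constructor
  · rintro ⟨h1, h2, h3⟩
    exact ⟨h1, _, h3, affineCoord_mk φ v h2⟩
  · rintro ⟨h1, p, hp, hpv⟩
    have hv : v ≠ 0 := by rintro rfl; simp at h1
    refine ⟨h1, hv, ?_⟩
    obtain ⟨w, hw, rfl⟩ := exists_eq_mk p
    rw [affineCoord_mk] at hpv
    have : v = (φ v * (φ w)⁻¹) • w := by
      rw [mul_smul, hpv, smul_smul, mul_inv_cancel₀ h1.ne', one_smul]
    have h2 : Projectivization.mk ℝ v hv = Projectivization.mk ℝ w hw :=
      (Projectivization.mk_eq_mk_iff' ℝ _ _ _ _).2 ⟨_, this.symm⟩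
    rwa [h2]

theorem add_mem_coneOver_of_convex (hconv : Convex ℝ (affineCoord φ '' A))
    {u v : Fin d → ℝ} (hu : u ∈ coneOver φ A) (hv : v ∈ coneOver φ A) : u + v ∈ coneOver φ A := by
  rw [mem_coneOver_iff] at *
  obtain ⟨hu1, hu2⟩ := hu
  obtain ⟨hv1, hv2⟩ := hv
  have hpos : 0 < φ u + φ v := add_pos hu1 hv1
  refine ⟨by rwa [map_add], ?_⟩
  have := hconv hu2 hv2 (a := φ u / (φ u + φ v)) (b := φ v / (φ u + φ v)) (by positivity)
    (by positivity) (by field_simp)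
  convert this using 1
  rw [map_add, smul_smul, smul_smul, smul_add]
  congr 2 <;> field_simp

/-- Convexity does not depend on the affine chart: a convex set that is contained in the chart
of `φ`, whatever chart witnesses its convexity, has a convex cone with respect to `φ`. -/
theorem IsConvex.add_mem_coneOver (hA : A ⊆ affineChart φ) (hconv : IsConvex A)
    {u v : Fin d → ℝ} (hu : u ∈ coneOver φ A) (hv : v ∈ coneOver φ A) : u + v ∈ coneOver φ A := by
  obtain ⟨ψ, -, hAψ, hψ⟩ := hconv
  have hadd : ∀ a ∈ coneOver ψ A, ∀ b ∈ coneOver ψ A, a + b ∈ coneOver ψ A := fun a ha b hb =>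
    add_mem_coneOver_of_convex hψ ha hb
  have hφ : ∀ a ∈ coneOver ψ A, φ a ≠ 0 := fun a ⟨_, h2, h3⟩ =>
    (mk_mem_affineChart φ a h2).1 (hA h3)
  -- representatives on different sides of `ψ` would give a point of `A` outside the chart of `φ`
  have hmix : ∀ a b, 0 < φ a → 0 < φ b → a ∈ coneOver ψ A → -b ∈ coneOver ψ A → False := by
    intro a b ha hb ha' hb'
    refine hφ _ (hadd _ (smul_mem_coneOver hb ha') _ (smul_mem_coneOver ha hb')) ?_
    simp [mul_comm]
  obtain ⟨hu1, hu2, hu3⟩ := hu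
  obtain ⟨hv1, hv2, hv3⟩ := hv
  have hpos : 0 < φ (u + v) := by rw [map_add]; exact add_pos hu1 hv1
  have h0 : u + v ≠ 0 := fun h => by simp [h] at hpos
  refine ⟨hpos, h0, ?_⟩
  rcases mem_coneOver_or_neg_mem hAψ hu2 hu3 with h | h <;>
    rcases mem_coneOver_or_neg_mem hAψ hv2 hv3 with h' | h'
  · exact (hadd u h v h').2.2
  · exact (hmix u v hu1 hv1 h h').elim
  · exact (hmix v u hv1 hu1 h' h).elim
  · obtain ⟨_, h2, h3⟩ := hadd _ h _ h'
    rw [← mk_neg_eq (u + v) h0 (neg_ne_zero.2 h0)]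
    simpa only [neg_add] using h3

theorem isOpen_iff_isOpen_preimage :
    IsOpen A ↔ IsOpen {v : Fin d → ℝ | ∃ hv : v ≠ 0, Projectivization.mk ℝ v hv ∈ A} := by
  have h1 : IsOpen A ↔ IsOpen {v : {v : Fin d → ℝ // v ≠ 0} |
      Projectivization.mk ℝ v.1 v.2 ∈ A} := Iff.rfl
  have h2 : IsOpen {v : Fin d → ℝ | v ≠ 0} := isOpen_ne
  rw [h1, h2.isOpenEmbedding_subtypeVal.isOpen_iff_image_isOpen]
  congr! 1
  ext v
  simp

theorem isOpen_coneOver (hA : IsOpen A) : IsOpen (coneOver φ A) := by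
  have hφ : Continuous φ := LinearMap.continuous_of_finiteDimensional φ
  exact (isOpen_lt continuous_const hφ).inter (isOpen_iff_isOpen_preimage.1 hA)

theorem exists_norm_le_of_isBounded
    (hb : Bornology.IsBounded (affineCoord φ '' A)) :
    ∃ R : ℝ, ∀ v ∈ coneOver φ A, ‖v‖ ≤ R * φ v := by
  obtain ⟨R, hR⟩ := hb.exists_norm_le
  refine ⟨R, fun v hv => ?_⟩
  obtain ⟨h1, h2⟩ := mem_coneOver_iff.1 hv
  have := hR _ h2
  rwa [norm_smul, norm_inv, Real.norm_of_nonneg h1.le, inv_mul_le_iff₀ h1, mul_comm] at this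

/-- The cone over a relatively closed subset is relatively closed. -/
theorem mem_coneOver_of_mem_closure (hAB : A ⊆ B) (hcl : IsClosed ((↑) ⁻¹' A : Set B))
    {v : Fin d → ℝ} (hv : v ∈ coneOver φ B) (hvA : v ∈ closure (coneOver φ A)) :
    v ∈ coneOver φ A := by
  obtain ⟨h1, h2, h3⟩ := hv
  obtain ⟨F, hF, hFA⟩ := isClosed_induced_iff.1 hcl
  have hFA' : ∀ p ∈ B, (p ∈ F ↔ p ∈ A) := fun p hp => Set.ext_iff.1 hFA ⟨p, hp⟩
  refine ⟨h1, h2, (hFA' _ h3).1 ?_⟩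
  by_contra hvF
  obtain ⟨w, ⟨hw1, hw2⟩, hw3, hw4, hw5⟩ := mem_closure_iff.1 hvA _
    (isOpen_iff_isOpen_preimage.1 hF.isOpen_compl) ⟨h2, hvF⟩
  exact hw2 ((hFA' _ (hAB hw5)).2 hw5)

end Cone

/-! ### Lifting projective transformations -/

theorem GL.ext_smul {g h : GL (Fin d) ℝ} (hgh : ∀ v : Fin d → ℝ, g • v = h • v) : g = h := by
  refine Units.ext (Matrix.mulVec_injective (funext hgh))

theorem GL.exists_of_linearEquiv (L : (Fin d → ℝ) ≃ₗ[ℝ] (Fin d → ℝ)) :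
    ∃ g : GL (Fin d) ℝ, ∀ v : Fin d → ℝ, g • v = L v := by
  refine ⟨Matrix.GeneralLinearGroup.toLin.symm (LinearMap.GeneralLinearGroup.ofLinearEquiv L),
    fun v => ?_⟩
  have h := Matrix.GeneralLinearGroup.toLin_apply (Matrix.GeneralLinearGroup.toLin.symm
    (LinearMap.GeneralLinearGroup.ofLinearEquiv L)) v
  rw [MulEquiv.apply_symm_apply] at h
  exact h.symm

theorem PGL.mk_smul_mk' (g : GL (Fin d) ℝ) (v : Fin d → ℝ) (hv : v ≠ 0) (hgv : g • v ≠ 0) :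
    (Matrix.ProjGenLinGroup.mk g : PGL d) • Projectivization.mk ℝ v hv =
      Projectivization.mk ℝ (g • v) hgv := rfl

theorem PGL.mk_neg (g : GL (Fin d) ℝ) :
    Matrix.ProjGenLinGroup.mk (-g) = Matrix.ProjGenLinGroup.mk g := by
  refine (Matrix.ProjGenLinGroup.mk_eq_mk_iff.2 ⟨-1, ?_⟩).symm
  refine GL.ext_smul fun v => ?_
  rw [mul_smul, Units.neg_smul, ← smul_neg]
  congr 1
  change (Matrix.scalar (Fin d) (-1 : ℝ)).mulVec v = -v
  ext i
  simp [Matrix.mulVec_diagonal]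

section Lift

variable {φ : Module.Dual ℝ (Fin d → ℝ)} {Ω : Set (RP d)}

/-- A projective automorphism of `Ω` lifts to a linear map that preserves the cone over `Ω`. -/
theorem exists_lift (hΩ : Ω ⊆ affineChart φ)
    (hadd : ∀ u ∈ coneOver φ Ω, ∀ v ∈ coneOver φ Ω, u + v ∈ coneOver φ Ω)
    {g : PGL d} (hg : g • Ω = Ω) :
    ∃ A : GL (Fin d) ℝ, Matrix.ProjGenLinGroup.mk A = g ∧
      ∀ v ∈ coneOver φ Ω, A • v ∈ coneOver φ Ω := by
  obtain ⟨A, rfl⟩ := Matrix.ProjGenLinGroup.mk_surjective g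
  have hA : ∀ v ∈ coneOver φ Ω, A • v ∈ coneOver φ Ω ∨ -(A • v) ∈ coneOver φ Ω := by
    rintro v ⟨h1, h2, h3⟩
    refine mem_coneOver_or_neg_mem hΩ ((smul_ne_zero_iff_ne A).2 h2) ?_
    rw [← PGL.mk_smul_mk' A v h2, ← hg]
    exact Set.smul_mem_smul_set h3
  -- vectors with images on different sides would combine to one whose image has `φ = 0`
  have hmix : ∀ u ∈ coneOver φ Ω, ∀ v ∈ coneOver φ Ω, 0 < φ (A • u) → φ (A • v) < 0 → False := by
    intro u hu v hv h1 h2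
    have hw : φ (A • (-φ (A • v) • u + φ (A • u) • v)) = 0 := by
      rw [smul_add, smul_comm A (_ : ℝ) u, smul_comm A (_ : ℝ) v, map_add,
        LinearMap.map_smul, LinearMap.map_smul]
      simp only [smul_eq_mul]; ring
    rcases hA _ (hadd _ (smul_mem_coneOver (neg_pos.2 h2) hu) _ (smul_mem_coneOver h1 hv))
      with h | h
    · exact h.1.ne' hw
    · have := h.1
      rw [map_neg, hw, neg_zero] at this
      exact this.false
  by_cases hex : ∃ u ∈ coneOver φ Ω, 0 < φ (A • u)
  · obtain ⟨u, hu, hφu⟩ := hex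
    refine ⟨A, rfl, fun v hv => (hA v hv).resolve_right fun h => hmix u hu v hv hφu ?_⟩
    have := h.1
    rw [map_neg] at this
    linarith
  · push Not at hex
    refine ⟨-A, PGL.mk_neg A, fun v hv => ?_⟩
    rw [Units.neg_smul]
    exact (hA v hv).resolve_left fun h => (hex v hv).not_gt h.1

/-- Lifts that preserve a cone commute if the projective transformations do: the commutator is
a positive scalar of determinant one. -/
theorem commute_of_lift {A B : GL (Fin d) ℝ} {v : Fin d → ℝ}
    (hA : ∀ v ∈ coneOver φ Ω, A • v ∈ coneOver φ Ω)
    (hB : ∀ v ∈ coneOver φ Ω, B • v ∈ coneOver φ Ω) (hv : v ∈ coneOver φ Ω)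
    (hAB : (Matrix.ProjGenLinGroup.mk A : PGL d) * Matrix.ProjGenLinGroup.mk B =
      Matrix.ProjGenLinGroup.mk B * Matrix.ProjGenLinGroup.mk A) (x : Fin d → ℝ) :
    A • B • x = B • A • x := by
  rw [← map_mul, ← map_mul, Matrix.ProjGenLinGroup.mk_eq_mk_iff] at hAB
  obtain ⟨c, hc⟩ := hAB
  have hsc : ∀ x : Fin d → ℝ, Matrix.GeneralLinearGroup.scalar (Fin d) c • x = (c : ℝ) • x := by
    intro x
    change (Matrix.scalar (Fin d) (c : ℝ)).mulVec x = (c : ℝ) • x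
    ext i
    simp [Matrix.mulVec_diagonal]
  have hx : ∀ x : Fin d → ℝ, (c : ℝ) • A • B • x = B • A • x := by
    intro x
    rw [smul_smul B A x, ← hc, mul_smul, hsc, mul_smul, smul_comm B (_ : ℝ) x, smul_comm A (_ : ℝ)]
  have hcpos : 0 < (c : ℝ) := by
    have h1 := (hA _ (hB v hv)).1
    have h2 := (hB _ (hA v hv)).1
    rw [← hx v, map_smul, smul_eq_mul] at h2
    exact pos_of_mul_pos_left h2 h1.le
  have hd : d ≠ 0 := by
    rintro rfl
    exact hv.2.1 (Subsingleton.elim _ _)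
  have hdet : (c : ℝ) ^ d = 1 := by
    have h3 := congrArg (fun g : GL (Fin d) ℝ => (g : Matrix (Fin d) (Fin d) ℝ).det) hc
    simp only [Units.val_mul, Matrix.det_mul] at h3
    have h4 : (Matrix.GeneralLinearGroup.scalar (Fin d) c : Matrix (Fin d) (Fin d) ℝ).det =
        (c : ℝ) ^ d := by
      change (Matrix.scalar (Fin d) (c : ℝ)).det = _
      simp
    rw [h4, mul_comm (B : Matrix (Fin d) (Fin d) ℝ).det] at h3
    have h5 : (A : Matrix (Fin d) (Fin d) ℝ).det * (B : Matrix (Fin d) (Fin d) ℝ).det ≠ 0 :=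
      mul_ne_zero (Matrix.isUnits_det_units A).ne_zero (Matrix.isUnits_det_units B).ne_zero
    exact mul_left_cancel₀ h5 (h3.trans (mul_one _).symm)
  have hc1 : (c : ℝ) = 1 := (pow_eq_one_iff_of_nonneg hcpos.le hd).1 hdet
  rw [← hx x, hc1, one_smul]

end Lift

/-! ### Minimal invariant convex sets -/

theorem isClosedEmbedding_inclusion {X : Type*} [TopologicalSpace X] {S C : Set X} (hSC : S ⊆ C)
    (hcl : IsClosed ((↑) ⁻¹' S : Set C)) : Topology.IsClosedEmbedding (Set.inclusion hSC) := by
  refine ⟨Topology.IsEmbedding.inclusion hSC, ?_⟩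
  rw [Set.range_inclusion]
  exact hcl

/-- Co-compactness is inherited by relatively closed invariant subsets. -/
theorem ActsCocompactlyOn.of_isClosed {G : Subgroup (PGL d)} {S C : Set (RP d)}
    (hC : ActsCocompactlyOn G C) (hSC : S ⊆ C) (hcl : IsClosed ((↑) ⁻¹' S : Set C))
    (hS : ∀ g ∈ G, ∀ p ∈ S, g • p ∈ S) : ActsCocompactlyOn G S := by
  refine ⟨fun g hg => ?_, ?_⟩
  · refine Set.Subset.antisymm ?_ fun p hp => ?_
    · rintro _ ⟨p, hp, rfl⟩
      exact hS g hg p hp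
    · exact Set.mem_smul_set_iff_inv_smul_mem.2 (hS _ (inv_mem hg) p hp)
  have := hC.2
  let rS : Setoid S := (MulAction.orbitRel G (RP d)).comap Subtype.val
  let rC : Setoid C := (MulAction.orbitRel G (RP d)).comap Subtype.val
  let j : Quotient rS → Quotient rC := Quotient.map (Set.inclusion hSC) fun _ _ h => h
  have hjc : Continuous j :=
    Continuous.quotient_map' (continuous_inclusion hSC) fun _ _ h => h
  have hj : Function.Injective j := by
    rintro ⟨a⟩ ⟨b⟩ hab
    have h : rC (Set.inclusion hSC a) (Set.inclusion hSC b) := Quotient.exact hab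
    exact Quotient.sound h
  have hjcl : IsClosedMap j := by
    intro Z hZ
    rw [← isQuotientMap_quotient_mk'.isClosed_preimage] at hZ ⊢
    convert (isClosedEmbedding_inclusion hSC hcl).isClosedMap _ hZ using 1
    ext c
    constructor
    · rintro ⟨⟨s⟩, hs, hsc⟩
      have h : rC (Set.inclusion hSC s) c := Quotient.exact hsc
      obtain ⟨g, hg⟩ := MulAction.orbitRel_apply.1 (rC.symm h)
      have hcS : c.1 ∈ S := by
        rw [← show g • s.1 = c.1 from hg]
        exact hS g g.2 s.1 s.2
      refine ⟨⟨c.1, hcS⟩, ?_, rfl⟩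
      have h2 : rS s ⟨c.1, hcS⟩ := h
      change Quotient.mk rS ⟨c.1, hcS⟩ ∈ Z
      rwa [← Quotient.sound h2]
    · rintro ⟨s, hs, rfl⟩
      exact ⟨_, hs, rfl⟩
  exact (Topology.IsClosedEmbedding.of_continuous_injective_isClosedMap hjc hj hjcl).compactSpace

/-- A convex set with a co-compact action contains a minimal non-empty relatively closed invariant
convex subset. -/
theorem exists_minimal_invariant {φ : Module.Dual ℝ (Fin d → ℝ)} {G : Subgroup (PGL d)}
    {C : Set (RP d)} (hC : ActsCocompactlyOn G C) (hne : C.Nonempty)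
    (hadd : ∀ u ∈ coneOver φ C, ∀ v ∈ coneOver φ C, u + v ∈ coneOver φ C) :
    ∃ S ⊆ C, S.Nonempty ∧ IsClosed ((↑) ⁻¹' S : Set C) ∧ (∀ g ∈ G, ∀ p ∈ S, g • p ∈ S) ∧
      (∀ u ∈ coneOver φ S, ∀ v ∈ coneOver φ S, u + v ∈ coneOver φ S) ∧
      ∀ T ⊆ S, T.Nonempty → IsClosed ((↑) ⁻¹' T : Set C) → (∀ g ∈ G, ∀ p ∈ T, g • p ∈ T) →
        (∀ u ∈ coneOver φ T, ∀ v ∈ coneOver φ T, u + v ∈ coneOver φ T) → T = S := by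
  have := hC.2
  let r : Setoid C := (MulAction.orbitRel G (RP d)).comap (Subtype.val : C → RP d)
  let U : Set (Quotient r) → Set (RP d) := fun B => {p | ∃ h : p ∈ C, Quotient.mk r ⟨p, h⟩ ∈ B}
  have hUC : ∀ B, U B ⊆ C := fun B p hp => hp.1
  have hpre : ∀ B, ((↑) ⁻¹' U B : Set C) = Quotient.mk r ⁻¹' B := by
    intro B
    ext c
    exact ⟨fun h => h.2, fun h => ⟨c.2, h⟩⟩
  have hUinv : ∀ B, ∀ g ∈ G, ∀ p ∈ U B, g • p ∈ U B := by
    rintro B g hg p ⟨hp, hpB⟩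
    have hgp : g • p ∈ C := by
      rw [← hC.1 g hg]
      exact Set.smul_mem_smul_set hp
    refine ⟨hgp, ?_⟩
    have h : r ⟨g • p, hgp⟩ ⟨p, hp⟩ := MulAction.orbitRel_apply.2 ⟨⟨g, hg⟩, rfl⟩
    rwa [Quotient.sound h]
  obtain ⟨c, hc⟩ := hne
  obtain ⟨B, ⟨hB1, hB2⟩, ⟨⟨b⟩, hb⟩, -, hmin⟩ := exists_minimal_nonempty_of_isClosed
    (fun B : Set (Quotient r) => IsClosed B ∧
      ∀ u ∈ coneOver φ (U B), ∀ v ∈ coneOver φ (U B), u + v ∈ coneOver φ (U B))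
    (fun B hB => hB.1)
    (by
      intro c hcne hc
      refine ⟨isClosed_sInter fun B hB => (hc B hB).1, fun u hu v hv => ?_⟩
      have hsub : ∀ B ∈ c, U (⋂₀ c) ⊆ U B := fun B hB p ⟨h1, h2⟩ => ⟨h1, h2 B hB⟩
      have key : ∀ B ∈ c, u + v ∈ coneOver φ (U B) := fun B hB =>
        (hc B hB).2 u (coneOver_mono (hsub B hB) hu) v (coneOver_mono (hsub B hB) hv)
      obtain ⟨B, hB⟩ := hcne
      obtain ⟨h1, h2, h3, -⟩ := key B hB
      exact ⟨h1, h2, h3, fun B' hB' => (key B' hB').2.2.2⟩)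
    (B₀ := Set.univ)
    (by
      have : U Set.univ = C := Set.Subset.antisymm (hUC _) fun p hp => ⟨hp, trivial⟩
      refine ⟨isClosed_univ, ?_⟩
      rw [this]
      exact hadd) ⟨Quotient.mk r ⟨c, hc⟩, trivial⟩
  refine ⟨U B, hUC B, ⟨b.1, b.2, hb⟩, ?_, hUinv B, hB2, ?_⟩
  · rw [hpre]
    exact hB1.preimage continuous_quotient_mk'
  intro T hTS ⟨t, ht⟩ hTcl hTinv hTadd
  let B' : Set (Quotient r) := Quotient.mk r '' ((↑) ⁻¹' T)
  have hUB' : U B' = T := by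
    ext p
    constructor
    · rintro ⟨hp, q, hq, hqp⟩
      have h : r q ⟨p, hp⟩ := Quotient.exact hqp
      obtain ⟨g, hg⟩ := MulAction.orbitRel_apply.1 (r.symm h)
      rw [← show g • q.1 = p from hg]
      exact hTinv g g.2 _ hq
    · exact fun hp => ⟨hUC B (hTS hp), _, hp, rfl⟩
  have hB' := hmin B' ⟨?_, by rwa [hUB']⟩ ⟨_, ⟨t, hUC B (hTS ht)⟩, ht, rfl⟩ ?_
  · rw [← hB', hUB']
  · rw [← isQuotientMap_quotient_mk'.isClosed_preimage]
    change IsClosed (Quotient.mk r ⁻¹' B')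
    rwa [← hpre, hUB']
  · rintro _ ⟨q, hq, rfl⟩
    exact (hTS hq).2

/-! ### The cone over a minimal invariant convex set -/

/-- The lifts to `GL_d(ℝ)` of the elements of `G` that preserve the cone over `Ω`. -/
def coneLifts (φ : Module.Dual ℝ (Fin d → ℝ)) (Ω : Set (RP d)) (G : Subgroup (PGL d)) :
    Set (GL (Fin d) ℝ) :=
  {A | Matrix.ProjGenLinGroup.mk A ∈ G ∧ ∀ v ∈ coneOver φ Ω, A • v ∈ coneOver φ Ω}

/-- The linear maps that the lifts of `G` induce on a subspace. -/
def inducedMaps (φ : Module.Dual ℝ (Fin d → ℝ)) (Ω : Set (RP d)) (G : Subgroup (PGL d))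
    (V : Submodule ℝ (Fin d → ℝ)) : Set (Module.End ℝ V) :=
  {T | ∃ A ∈ coneLifts φ Ω G, ∀ x : V, (T x : Fin d → ℝ) = A • (x : Fin d → ℝ)}

theorem GL.continuous_smul (A : GL (Fin d) ℝ) : Continuous fun v : Fin d → ℝ => A • v :=
  LinearMap.continuous_of_finiteDimensional (Matrix.mulVecLin A.1)

section

variable {φ : Module.Dual ℝ (Fin d → ℝ)} {Ω S : Set (RP d)} {G : Subgroup (PGL d)}

theorem lift_smul_mem (hSΩ : S ⊆ Ω) (hinv : ∀ g ∈ G, ∀ p ∈ S, g • p ∈ S) {A : GL (Fin d) ℝ}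
    (hA : A ∈ coneLifts φ Ω G) {v : Fin d → ℝ} (hv : v ∈ coneOver φ S) : A • v ∈ coneOver φ S := by
  obtain ⟨h1, h2, -⟩ := hA.2 v (coneOver_mono hSΩ hv)
  exact ⟨h1, h2, hinv _ hA.1 _ hv.2.2⟩

theorem mulVecLin_mem_span (hSΩ : S ⊆ Ω) (hinv : ∀ g ∈ G, ∀ p ∈ S, g • p ∈ S)
    {A : GL (Fin d) ℝ} (hA : A ∈ coneLifts φ Ω G) :
    ∀ x ∈ Submodule.span ℝ (coneOver φ S),
      Matrix.mulVecLin A.1 x ∈ Submodule.span ℝ (coneOver φ S) := by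
  have : Submodule.span ℝ (coneOver φ S) ≤
      (Submodule.span ℝ (coneOver φ S)).comap (Matrix.mulVecLin A.1) :=
    Submodule.span_le.2 fun v hv => Submodule.subset_span (lift_smul_mem hSΩ hinv hA hv)
  exact this

theorem isClosedCone_closure (hne : (coneOver φ S).Nonempty)
    (hadd : ∀ u ∈ coneOver φ S, ∀ v ∈ coneOver φ S, u + v ∈ coneOver φ S) :
    IsClosedCone (closure (coneOver φ S)) := by
  have h0 : (0 : Fin d → ℝ) ∈ closure (coneOver φ S) := by
    obtain ⟨v, hv⟩ := hne
    have h1 : Filter.Tendsto (fun c : ℝ => c • v) (nhdsWithin 0 (Set.Ioi 0)) (nhds ((0 : ℝ) • v)) :=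
      (Filter.tendsto_id.mono_left nhdsWithin_le_nhds).smul_const v
    rw [zero_smul] at h1
    exact mem_closure_of_tendsto h1 (Filter.mem_of_superset self_mem_nhdsWithin
      fun c hc => smul_mem_coneOver hc hv)
  refine ⟨isClosed_closure, h0, fun x hx y hy => map_mem_closure₂ continuous_add hx hy hadd,
    fun c hc x hx => ?_⟩
  rcases hc.eq_or_lt with rfl | hc
  · rwa [zero_smul]
  · exact map_mem_closure (continuous_const_smul c) hx fun v hv => smul_mem_coneOver hc hv

/-- The points of a relatively closed set that lie in the projectivization of a closed cone form a
relatively closed set. -/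
theorem isClosed_coneOver_inter {C : Set (RP d)} (hS : S ⊆ affineChart φ)
    (hScl : IsClosed ((↑) ⁻¹' S : Set C)) {N : Set (Fin d → ℝ)} (hN : IsClosedCone N)
    (hNφ : ∀ x ∈ N, 0 ≤ φ x) :
    IsClosed ((↑) ⁻¹' {p | ∃ (v : Fin d → ℝ) (hv : v ≠ 0), p = Projectivization.mk ℝ v hv ∧
      v ∈ coneOver φ S ∧ v ∈ N} : Set C) := by
  let Z : Set (RP d) := {p | ∃ (v : Fin d → ℝ) (hv : v ≠ 0), p = Projectivization.mk ℝ v hv ∧ v ∈ N}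
  have hZ : IsClosed Z := by
    rw [← isOpen_compl_iff, isOpen_iff_isOpen_preimage]
    have : {v : Fin d → ℝ | ∃ hv : v ≠ 0, Projectivization.mk ℝ v hv ∈ Zᶜ} =
        {v | v ≠ 0} ∩ (N ∪ -N)ᶜ := by
      ext v
      constructor
      · rintro ⟨hv, hvZ⟩
        refine ⟨hv, ?_⟩
        rintro (h | h)
        · exact hvZ ⟨v, hv, rfl, h⟩
        · exact hvZ ⟨-v, neg_ne_zero.2 hv, (mk_neg_eq v hv _).symm, h⟩
      · rintro ⟨hv, hvN⟩
        refine ⟨hv, ?_⟩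
        rintro ⟨w, hw, hwv, hwN⟩
        obtain ⟨c, rfl⟩ := (Projectivization.mk_eq_mk_iff' ℝ _ _ _ _).1 hwv
        rcases le_total 0 c with hc | hc
        · exact hvN (Or.inl (hN.smul_mem c hc w hwN))
        · refine hvN (Or.inr ?_)
          rw [Set.mem_neg, ← neg_smul]
          exact hN.smul_mem _ (neg_nonneg.2 hc) w hwN
    rw [this]
    exact isOpen_ne.inter (hN.isClosed.union hN.isClosed.neg).isOpen_compl
  convert hScl.inter (hZ.preimage continuous_subtype_val) using 1
  ext p
  constructor
  · rintro ⟨v, hv, hpv, ⟨h1, h2, h3⟩, hvN⟩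
    refine ⟨?_, v, hv, hpv, hvN⟩
    change p.1 ∈ S
    rwa [hpv]
  · rintro ⟨hpS, w, hw, hpw, hwN⟩
    obtain ⟨v, hv, hv0, hvp⟩ := exists_mem_coneOver hS hpS
    refine ⟨v, hv0, hvp.symm, hv, ?_⟩
    obtain ⟨c, rfl⟩ := (Projectivization.mk_eq_mk_iff' ℝ _ _ hv0 hw).1 (hvp.trans hpw)
    have h1 := hv.1
    rw [map_smul, smul_eq_mul] at h1
    exact hN.smul_mem c (pos_of_mul_pos_left h1 (hNφ w hwN)).le w hwN

/-- The cone `D` over a minimal invariant convex set `S` and the closure of `D` satisfy the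
hypotheses of `IsMinimalCone` in the span of `D`. -/
theorem isMinimalCone_coneOver {C : Set (RP d)} (hΩ : Ω ⊆ affineChart φ) (hΩo : IsOpen Ω)
    (hΩadd : ∀ u ∈ coneOver φ Ω, ∀ v ∈ coneOver φ Ω, u + v ∈ coneOver φ Ω)
    {R : ℝ} (hR : ∀ v ∈ coneOver φ Ω, ‖v‖ ≤ R * φ v)
    (hGΩ : ∀ g ∈ G, g • Ω = Ω) (hGab : ∀ a ∈ G, ∀ b ∈ G, a * b = b * a)
    (hSΩ : S ⊆ Ω) (hSne : S.Nonempty) (hSC' : IsClosed ((↑) ⁻¹' S : Set C))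
    (hScl : IsClosed ((↑) ⁻¹' S : Set Ω))
    (hinv : ∀ g ∈ G, ∀ p ∈ S, g • p ∈ S)
    (hadd : ∀ u ∈ coneOver φ S, ∀ v ∈ coneOver φ S, u + v ∈ coneOver φ S)
    (hmin : ∀ T ⊆ S, T.Nonempty → IsClosed ((↑) ⁻¹' T : Set C) →
      (∀ g ∈ G, ∀ p ∈ T, g • p ∈ T) →
        (∀ u ∈ coneOver φ T, ∀ v ∈ coneOver φ T, u + v ∈ coneOver φ T) → T = S) :
    IsMinimalCone (inducedMaps φ Ω G (Submodule.span ℝ (coneOver φ S)))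
      (Subtype.val ⁻¹' closure (coneOver φ S)) (Subtype.val ⁻¹' coneOver φ S) := by
  set D := coneOver φ S with hD
  have hφ : Continuous φ := LinearMap.continuous_of_finiteDimensional φ
  have hSφ : S ⊆ affineChart φ := hSΩ.trans hΩ
  have hDne : D.Nonempty := by
    obtain ⟨p, hp⟩ := hSne
    obtain ⟨v, hv, -⟩ := exists_mem_coneOver hSφ hp
    exact ⟨v, hv⟩
  have hDΩ : D ⊆ coneOver φ Ω := coneOver_mono hSΩ
  have hK := isClosedCone_closure hDne hadd
  set K := closure D with hKdef
  have hDK : D ⊆ K := subset_closure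
  have hKV : K ⊆ (Submodule.span ℝ D : Set (Fin d → ℝ)) :=
    closure_minimal Submodule.subset_span (Submodule.closed_of_finiteDimensional _)
  have hKφ : ∀ x ∈ K, 0 ≤ φ x :=
    closure_minimal (fun x hx => hx.1.le) (isClosed_le continuous_const hφ)
  have hKR : ∀ x ∈ K, ‖x‖ ≤ R * φ x :=
    closure_minimal (fun x hx => hR x (hDΩ hx))
      (isClosed_le continuous_norm (continuous_const.mul hφ))
  have hAK : ∀ A ∈ coneLifts φ Ω G, ∀ x ∈ K, A • x ∈ K := fun A hA x hx =>
    map_mem_closure (GL.continuous_smul A) hx fun v hv => lift_smul_mem hSΩ hinv hA hv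
  have hval : Topology.IsClosedEmbedding (Subtype.val : Submodule.span ℝ D → Fin d → ℝ) :=
    (Submodule.closed_of_finiteDimensional (Submodule.span ℝ D)).isClosedEmbedding_subtypeVal
  constructor
  · exact ⟨hK.isClosed.preimage continuous_subtype_val, hK.zero_mem,
      fun x hx y hy => hK.add_mem _ hx _ hy, fun c hc x hx => hK.smul_mem c hc _ hx⟩
  · intro x hx hx'
    have h1 := hKφ _ hx
    have h2 := hKφ _ hx'
    rw [Submodule.coe_neg, map_neg] at h2
    have h3 := hKR _ hx
    rw [le_antisymm (by linarith) h1, mul_zero] at h3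
    exact Subtype.ext (norm_le_zero_iff.1 h3)
  · refine top_le_iff.1 ((Submodule.span_span_coe_preimage (R := ℝ) (s := D)).ge.trans ?_)
    exact Submodule.span_mono fun x hx => hDK hx
  · rintro a ⟨A, hA, haA⟩ b ⟨B, hB, hbB⟩ x
    obtain ⟨v, hv⟩ := hDne
    refine Subtype.ext ?_
    rw [haA, hbB, hbB, haA]
    exact commute_of_lift hA.2 hB.2 (hDΩ hv) (hGab _ hA.1 _ hB.1) _
  · rintro a ⟨A, hA, haA⟩ x hx
    change (a x : Fin d → ℝ) ∈ K
    rw [haA]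
    exact hAK A hA _ hx
  · obtain ⟨v, hv⟩ := hDne
    exact ⟨⟨v, Submodule.subset_span hv⟩, hv⟩
  · exact fun x hx => hDK hx
  · intro x hx y hy
    refine mem_coneOver_of_mem_closure hSΩ hScl ?_ (hK.add_mem _ (hDK hx) _ hy)
    -- adding an element of the closure of an open cone does not leave the open cone
    have h1 : (x : Fin d → ℝ) + y ∈ coneOver φ Ω + closure (coneOver φ Ω) :=
      Set.add_mem_add (hDΩ hx) (closure_mono hDΩ hy)
    rw [(isOpen_coneOver hΩo).add_closure] at h1
    obtain ⟨a, ha, b, hb, hab⟩ := h1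
    have := hΩadd a ha b hb
    rwa [show a + b = (x : Fin d → ℝ) + y from hab] at this
  · exact fun c hc x hx => smul_mem_coneOver hc hx
  · rintro N hNK hN hNinv ⟨x, hxD, hxN⟩
    let N' : Set (Fin d → ℝ) := Subtype.val '' N
    have hN' : IsClosedCone N' := by
      refine ⟨hval.isClosedMap _ hN.isClosed, ⟨0, hN.zero_mem, rfl⟩, ?_, ?_⟩
      · rintro _ ⟨a, ha, rfl⟩ _ ⟨b, hb, rfl⟩
        exact ⟨a + b, hN.add_mem a ha b hb, rfl⟩
      · rintro c hc _ ⟨a, ha, rfl⟩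
        exact ⟨c • a, hN.smul_mem c hc a ha, rfl⟩
    have hN'K : N' ⊆ K := by
      rintro _ ⟨a, ha, rfl⟩
      exact hNK ha
    have hN'inv : ∀ A ∈ coneLifts φ Ω G, ∀ v ∈ N', A • v ∈ N' := by
      rintro A hA _ ⟨a, ha, rfl⟩
      let T : Module.End ℝ (Submodule.span ℝ D) := (Matrix.mulVecLin A.1).restrict
        (mulVecLin_mem_span hSΩ hinv hA)
      exact ⟨T a, hNinv T ⟨A, hA, fun x => rfl⟩ a ha, rfl⟩
    let T : Set (RP d) := {p | ∃ (v : Fin d → ℝ) (hv : v ≠ 0), p = Projectivization.mk ℝ v hv ∧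
      v ∈ coneOver φ S ∧ v ∈ N'}
    -- the cone over `T` is `D ∩ N'`
    have hTcone : ∀ v, v ∈ coneOver φ T → v ∈ D ∧ v ∈ N' := by
      rintro v ⟨h1, h2, w, hw, hvw, hwD, hwN⟩
      obtain ⟨c, hc, rfl⟩ := exists_pos_smul_eq h2 hw h1 hwD.1 hvw
      exact ⟨smul_mem_coneOver hc hwD, hN'.smul_mem c hc.le w hwN⟩
    have hTS : T = S := by
      refine hmin T ?_ ⟨_, x.1, hxD.2.1, rfl, hxD, x, hxN, rfl⟩
        (isClosed_coneOver_inter hSφ hSC' hN' fun y hy => hKφ y (hN'K hy)) ?_ ?_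
      · rintro p ⟨v, hv, rfl, ⟨_, _, h⟩, _⟩
        exact h
      · rintro g hg _ ⟨v, hv, rfl, hvD, hvN⟩
        obtain ⟨A, rfl, hA⟩ := exists_lift hΩ hΩadd (hGΩ g hg)
        exact ⟨A • v, (smul_ne_zero_iff_ne A).2 hv, rfl, lift_smul_mem hSΩ hinv ⟨hg, hA⟩ hvD,
          hN'inv A ⟨hg, hA⟩ v hvN⟩
      · intro u hu v hv
        obtain ⟨hu1, hu2⟩ := hTcone u hu
        obtain ⟨hv1, hv2⟩ := hTcone v hv
        have huv := hadd u hu1 v hv1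
        exact ⟨huv.1, huv.2.1, _, huv.2.1, rfl, huv, hN'.add_mem u hu2 v hv2⟩
    have hDN : D ⊆ N' := fun v hv => (hTcone v (by rwa [hTS])).2
    have hKN : K ⊆ N' := closure_minimal hDN hN'.isClosed
    refine Set.Subset.antisymm hNK fun y hy => ?_
    obtain ⟨z, hz, hzy⟩ := hKN hy
    rwa [← Subtype.ext hzy]

end

/-- Linearly independent vectors are carried to standard basis vectors by some `g ∈ GL_d(ℝ)`. -/
theorem GL.exists_smul_eq_single {n : ℕ} (hn : n ≤ d) {e : Fin n → Fin d → ℝ}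
    (he : LinearIndependent ℝ e) :
    ∃ g : GL (Fin d) ℝ, ∀ i, g • e i = Pi.single (Fin.castLE hn i) 1 := by
  have hs : LinearIndependent ℝ fun i : Fin n => (Pi.single (Fin.castLE hn i) 1 : Fin d → ℝ) :=
    (Pi.linearIndependent_single_one (Fin d) ℝ).comp _ (Fin.castLE_injective hn)
  have hfin : FiniteDimensional ℝ (Submodule.span ℝ (Set.range e)) :=
    FiniteDimensional.span_of_finite ℝ (Set.finite_range _)
  obtain ⟨L, hL⟩ := Submodule.exists_linearEquiv_restrict_eq
    (he.linearCombinationEquiv.symm ≪≫ₗ hs.linearCombinationEquiv)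
  obtain ⟨g, hg⟩ := GL.exists_of_linearEquiv L
  refine ⟨g, fun i => ?_⟩
  have h := hL ⟨e i, Submodule.subset_span ⟨i, rfl⟩⟩
  have h2 : he.linearCombinationEquiv.symm ⟨e i, Submodule.subset_span ⟨i, rfl⟩⟩ =
      Finsupp.single i 1 := by
    rw [LinearEquiv.symm_apply_eq]
    exact Subtype.ext (by simp)
  rw [hg, ← h, LinearEquiv.trans_apply, h2]
  simp

end ConvexProj

theorem mainTheorem3 {d : ℕ} (Ω C : Set (ConvexProj.RP d))
    (hΩ : ConvexProj.IsProperlyConvexDomain Ω)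
    (hCΩ : C ⊆ Ω) (hCne : C.Nonempty)
    (hCclosed : IsClosed ((↑) ⁻¹' C : Set Ω))
    (hCconv : ConvexProj.IsConvex C)
    (G : Subgroup (ConvexProj.PGL d))
    (hGC : G ≤ ConvexProj.Stab Ω C)
    (hGab : ∀ a ∈ G, ∀ b ∈ G, a * b = b * a)
    (hGcc : ConvexProj.ActsCocompactlyOn G C) :
    ∃ (S : Set (ConvexProj.RP d)) (k : ℕ) (v : Fin k → ConvexProj.RP d),
      ConvexProj.IsSimplexWithVertices S v ∧
      ConvexProj.IsProperlyEmbedded S C ∧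
      G ≤ ConvexProj.Stab Ω S ∧
      ConvexProj.ActsCocompactlyOn G S ∧
      ∀ g ∈ G, ∀ i, g • v i = v i := by
  open ConvexProj in
  obtain ⟨⟨φ, -, hΩφ, hΩconv, hΩb⟩, hΩo⟩ := hΩ
  have hΩadd : ∀ u ∈ coneOver φ Ω, ∀ v ∈ coneOver φ Ω, u + v ∈ coneOver φ Ω :=
    fun u hu v hv => add_mem_coneOver_of_convex hΩconv hu hv
  obtain ⟨R, hR⟩ := exists_norm_le_of_isBounded hΩb
  have hGΩ : ∀ g ∈ G, g • Ω = Ω := fun g hg => (hGC hg).1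
  obtain ⟨S, hSC, hSne, hScl, hSinv, hSadd, hSmin⟩ := exists_minimal_invariant hGcc hCne
    fun u hu v hv => hCconv.add_mem_coneOver (hCΩ.trans hΩφ) hu hv
  have hSΩ : S ⊆ Ω := hSC.trans hCΩ
  have hSφ : S ⊆ affineChart φ := hSΩ.trans hΩφ
  have hSclΩ : IsClosed ((↑) ⁻¹' S : Set Ω) := by
    have := (isClosedEmbedding_inclusion hCΩ hCclosed).isClosedMap _ hScl
    convert this using 1
    ext p
    exact ⟨fun hp => ⟨⟨p, hSC hp⟩, hp, rfl⟩, by rintro ⟨q, hq, rfl⟩; exact hq⟩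
  have hScc := hGcc.of_isClosed hSC hScl hSinv
  obtain ⟨n, e, f, he, hfe, hsum, heig, hD⟩ := (isMinimalCone_coneOver hΩφ hΩo hΩadd hR hGΩ hGab
    hSΩ hSne hScl hSclΩ hSinv hSadd hSmin).exists_simplicial
  have heE : LinearIndependent ℝ fun i => (e i : Fin d → ℝ) :=
    he.map' (Submodule.subtype _) (Submodule.ker_subtype _)
  have hn : n ≤ d := by simpa using heE.fintype_card_le_finrank
  have he0 : ∀ i, (e i : Fin d → ℝ) ≠ 0 := heE.ne_zero
  obtain ⟨g, hg⟩ := GL.exists_smul_eq_single hn heE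
  have hgsum : ∀ c : Fin n → ℝ, ∀ j : Fin d, (g • ((∑ i, c i • e i : Submodule.span ℝ _) :
      Fin d → ℝ)) j = if h : (j : ℕ) < n then c ⟨j, h⟩ else 0 := by
    intro c j
    have h1 : g • ((∑ i, c i • e i : Submodule.span ℝ (coneOver φ S)) : Fin d → ℝ) =
        ∑ i, c i • (Pi.single (Fin.castLE hn i) 1 : Fin d → ℝ) := by
      simp only [Submodule.coe_sum, Submodule.coe_smul, Finset.smul_sum, smul_comm g (_ : ℝ), hg]
    rw [h1, Finset.sum_apply]
    split_ifs with h
    · rw [Finset.sum_eq_single ⟨j, h⟩]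
      · simp
      · intro b _ hb
        have : j ≠ Fin.castLE hn b := fun hj => hb (Fin.ext (by simp [hj]))
        simp [this]
      · simp
    · refine Finset.sum_eq_zero fun b _ => ?_
      have : j ≠ Fin.castLE hn b := fun hj => h (by simp [hj])
      simp [this]
  refine ⟨S, n, fun i => Projectivization.mk ℝ (e i : Fin d → ℝ) (he0 i),
    ⟨?_, hn, Matrix.ProjGenLinGroup.mk g, ?_, fun i => ?_⟩,
    ⟨hSC, (isClosedEmbedding_inclusion hSC hScl).isProperMap⟩,
    fun a ha => ⟨hGΩ a ha, hScc.1 a ha⟩, hScc, fun a ha i => ?_⟩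
  · -- for `n = 0` the span of the cone would be zero, but the cone contains a non-zero vector
    by_contra! hn0
    obtain ⟨p, hp⟩ := hSne
    obtain ⟨v, hv, hv0, -⟩ := exists_mem_coneOver hSφ hp
    obtain rfl : n = 0 := by omega
    refine hv0 ?_
    have := hsum ⟨v, Submodule.subset_span hv⟩
    simpa using (congrArg Subtype.val this).symm
  · ext p
    constructor
    · rintro ⟨q, hq, rfl⟩
      obtain ⟨v, hv, hv0, rfl⟩ := exists_mem_coneOver hSφ hq
      refine ⟨g • v, (smul_ne_zero_iff_ne g).2 hv0, rfl, fun j => ?_⟩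
      have hvpos := (hD ⟨v, Submodule.subset_span hv⟩).1 hv
      have hj := hgsum (fun i => f i ⟨v, Submodule.subset_span hv⟩) j
      rw [hsum] at hj
      change (g • v) j = _ at hj
      rw [hj]
      exact ⟨fun h => by rw [dif_pos h]; exact hvpos _, fun h => by rw [dif_neg (not_lt.2 h)]⟩
    · rintro ⟨x, hx, rfl, hxj⟩
      let w : Submodule.span ℝ (coneOver φ S) := ∑ i, x (Fin.castLE hn i) • e i
      have hw : w ∈ (Subtype.val ⁻¹' coneOver φ S : Set (Submodule.span ℝ (coneOver φ S))) := by
        refine (hD w).2 fun i => ?_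
        have : f i w = x (Fin.castLE hn i) := by simp [w, hfe]
        rw [this]
        exact (hxj _).1 i.2
      have hgw : g • (w : Fin d → ℝ) = x := by
        funext j
        rw [hgsum]
        split_ifs with h
        · rfl
        · exact ((hxj j).2 (not_lt.1 h)).symm
      obtain ⟨_, h2, h3⟩ := hw
      refine ⟨_, h3, ?_⟩
      simp only [Projectivization.PGL.mk_smul_mk, hgw]
  · rw [eq_inv_smul_iff]
    simp only [Projectivization.PGL.mk_smul_mk, hg, coordPoint]
  · obtain ⟨A, rfl, hA⟩ := exists_lift hΩφ hΩadd (hGΩ a ha)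
    obtain ⟨r, hr⟩ := heig i
      ((Matrix.mulVecLin A.1).restrict (mulVecLin_mem_span hSΩ hSinv ⟨ha, hA⟩))
      ⟨A, ⟨ha, hA⟩, fun x => rfl⟩
    have hr' : A • (e i : Fin d → ℝ) = r • (e i : Fin d → ℝ) := congrArg Subtype.val hr
    rw [Projectivization.PGL.mk_smul_mk, Projectivization.mk_eq_mk_iff']
    exact ⟨r, hr'.symm⟩
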